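/- Let $(A,\Delta)$ be a finite quantum group: $A\neq 0$ is a finite-dimensional unital C*-algebra and $\Delta:A\to A\otimes A$ is a unital $*$-homomorphism with $(\mathrm{id}\otimes\Delta)\Delta=(\Delta\otimes\mathrm{id})\Delta$ such that both $\mathrm{span}\{\Delta(b)(\mathbf 1\otimes a):a,b\in A\}$ and $\mathrm{span}\{\Delta(b)(a\otimes\mathbf 1):a,b\in A\}$ equal $A\otimes A$. Then $(A,\Delta)$ has a unique counit, i.e. a character $\varepsilon:A\to\mathbb C$ with $(\varepsilon\otimes\mathrm{id})\Delta=\mathrm{id}=(\mathrm{id}\otimes\varepsilon)\Delta$, and a unique Haar state, i.e. a state $h$ with $(\mathrm{id}\otimes h)\Delta(a)=h(a)\mathbf 1=(h\otimes\mathrm{id})\Delta(a)$ for all $a\in A$. Let $\phi$ be an idempotent state on $A$, i.e. a state with $(\phi\otimes\phi)\circ\Delta=\phi$. A *pre-subgroup* is an element $f\in A$ with $h(f^*f)=1$, $\varepsilon(f)>0$ and $\Delta(f)(\mathbf 1\otimes f)=f\otimes f$ (equivalently $V(f\otimes f)=f\otimes f$ for the multiplicative unitary $V(a\otimes b)=\Delta(a)(\mathbf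 1\otimes b)$ on $L^2(A,h)\otimes L^2(A,h)$, with $L^2(A,h)$ identified with $A$); it is a *subgroup* if moreover $f$ lies in the center of $A$. There is a unique pre-subgroup $f_\phi$ with $\phi(a)=h(f_\phi^*\,a f_\phi)$ for all $a\in A$. A *right coidalgebra* is a unital $*$-subalgebra $C\subseteq A$ with $\Delta(C)\subseteq A\otimes C$, and $C_\phi:=\{(\mathrm{id}\otimes\phi)\Delta(a):a\in A\}$ is one. A *quantum subgroup* of $(A,\Delta)$ is a finite quantum group $(B,\Delta_B)$ together with a surjective unital $*$-homomorphism $\pi:A\to B$ with $\Delta_B\circ\pi=(\pi\otimes\pi)\circ\Delta$; put $A/\!/B=\{a\in A:(\mathrm{id}\otimes\pi)\Delta(a)=a\otimes\mathbf 1_B\}$. Then the following are equivalent: 1. $\phi$ is a Haar idempotent state, i.e. $\phi=h_B\circ\pi$ for some quantum subgroup $(B,\Delta_B)$ with morphism $\pi$ and Haar state $h_B$; 2. the pre-subgroup $f_\phi$ is a subgroup; 3. the right coidalgebra $C_\phi$ is of quotient type, i.e. $C_\phi=A/\!/B$ for some quantum subgroup $(B,\Delta_B)$ with morphism $\pi$.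 -/

import Mathlib

open scoped TensorProduct ComplexOrder

universe u

noncomputable section

namespace FiniteQG

variable {A : Type u} [CStarAlgebra A] {B : Type u} [CStarAlgebra B]

/-- `(A, Δ)` is a finite quantum group: a nonzero finite-dimensional unital C*-algebra with a
unital `*`-homomorphism `Δ : A → A ⊗ A` which is coassociative and such that the elements
`Δ(b)(1 ⊗ a)`, respectively `Δ(b)(a ⊗ 1)`, span `A ⊗ A`. In finite dimension the C*-tensor
product is the algebraic one, and dense subspaces are everything. -/
structure IsFiniteQuantumGroup (Δ : A →⋆ₐ[ℂ] A ⊗[ℂ] A) : Prop where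
  nontrivial : Nontrivial A
  finiteDimensional : FiniteDimensional ℂ A
  coassoc : ∀ a : A,
    (TensorProduct.assoc ℂ A A A) (Δ.toAlgHom.toLinearMap.rTensor A (Δ a)) =
      Δ.toAlgHom.toLinearMap.lTensor A (Δ a)
  span_right : Submodule.span ℂ {x : A ⊗[ℂ] A | ∃ a b : A, x = Δ b * (1 ⊗ₜ[ℂ] a)} = ⊤
  span_left : Submodule.span ℂ {x : A ⊗[ℂ] A | ∃ a b : A, x = Δ b * (a ⊗ₜ[ℂ] 1)} = ⊤

/-- The slice map `ψ ⊗ id : A ⊗ A → A` of a linear functional. -/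
def sliceLeft (ψ : A →ₗ[ℂ] ℂ) : A ⊗[ℂ] A →ₗ[ℂ] A :=
  (TensorProduct.lid ℂ A).toLinearMap ∘ₗ ψ.rTensor A

/-- The slice map `id ⊗ ψ : A ⊗ A → A` of a linear functional. -/
def sliceRight (ψ : A →ₗ[ℂ] ℂ) : A ⊗[ℂ] A →ₗ[ℂ] A :=
  (TensorProduct.rid ℂ A).toLinearMap ∘ₗ ψ.lTensor A

/-- A state: a positive linear functional taking the value `1` at the unit. -/
def IsState (φ : A →ₗ[ℂ] ℂ) : Prop :=
  (∀ a : A, 0 ≤ φ (star a * a)) ∧ φ 1 = 1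

/-- A counit: a character `ε` with `(ε ⊗ id) ∘ Δ = id = (id ⊗ ε) ∘ Δ`. -/
def IsCounit (Δ : A →⋆ₐ[ℂ] A ⊗[ℂ] A) (ε : A →ₐ[ℂ] ℂ) : Prop :=
  ∀ a : A, sliceLeft ε.toLinearMap (Δ a) = a ∧ sliceRight ε.toLinearMap (Δ a) = a

/-- A Haar state: a state `h` with `(id ⊗ h)(Δ a) = h(a) 1 = (h ⊗ id)(Δ a)`. -/
def IsHaarState (Δ : A →⋆ₐ[ℂ] A ⊗[ℂ] A) (h : A →ₗ[ℂ] ℂ) : Prop :=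
  IsState h ∧ ∀ a : A, sliceRight h (Δ a) = h a • (1 : A) ∧ sliceLeft h (Δ a) = h a • (1 : A)

/-- The convolution product `ψ₁ ⋆ ψ₂ = (ψ₁ ⊗ ψ₂) ∘ Δ`. -/
def convolution (Δ : A →⋆ₐ[ℂ] A ⊗[ℂ] A) (ψ₁ ψ₂ : A →ₗ[ℂ] ℂ) : A →ₗ[ℂ] ℂ :=
  LinearMap.mul' ℂ ℂ ∘ₗ TensorProduct.map ψ₁ ψ₂ ∘ₗ Δ.toAlgHom.toLinearMap

/-- An idempotent state: a state `φ` with `φ ⋆ φ = φ`. -/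
def IsIdempotentState (Δ : A →⋆ₐ[ℂ] A ⊗[ℂ] A) (φ : A →ₗ[ℂ] ℂ) : Prop :=
  IsState φ ∧ convolution Δ φ φ = φ

/-- The multiplicative unitary `V(a ⊗ b) = Δ(a)(1 ⊗ b)`, where `L²(A, h)` is identified with `A`
through `a ↦ a 1_h`. -/
def multiplicativeUnitary (Δ : A →⋆ₐ[ℂ] A ⊗[ℂ] A) : A ⊗[ℂ] A →ₗ[ℂ] A ⊗[ℂ] A :=
  TensorProduct.lift ((LinearMap.mul ℂ (A ⊗[ℂ] A)).compl₁₂ Δ.toAlgHom.toLinearMap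
    (Algebra.TensorProduct.includeRight : A →ₐ[ℂ] A ⊗[ℂ] A).toLinearMap)

theorem multiplicativeUnitary_tmul (Δ : A →⋆ₐ[ℂ] A ⊗[ℂ] A) (a b : A) :
    multiplicativeUnitary Δ (a ⊗ₜ[ℂ] b) = Δ a * (1 ⊗ₜ[ℂ] b) := rfl

/-- A pre-subgroup, with respect to the counit `ε` and the Haar state `h`: a vector `f` of
`L²(A, h) = A` with `‖f‖² = h(f* f) = 1`, `ε(f) > 0` (that is, real and positive) and
`V(f ⊗ f) = f ⊗ f`. -/
structure IsPreSubgroup (Δ : A →⋆ₐ[ℂ] A ⊗[ℂ] A) (ε : A →ₐ[ℂ] ℂ) (h : A →ₗ[ℂ] ℂ) (f : A) :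
    Prop where
  norm_eq_one : h (star f * f) = 1
  counit_pos : 0 < ε f
  fixed : multiplicativeUnitary Δ (f ⊗ₜ[ℂ] f) = f ⊗ₜ[ℂ] f

/-- A subgroup: a pre-subgroup that belongs to the center of `A`. -/
def IsSubgroup (Δ : A →⋆ₐ[ℂ] A ⊗[ℂ] A) (ε : A →ₐ[ℂ] ℂ) (h : A →ₗ[ℂ] ℂ) (f : A) : Prop :=
  IsPreSubgroup Δ ε h f ∧ f ∈ Subalgebra.center ℂ A

/-- The vector functional `ω_{u,v}(a) = ⟨u, a v⟩ = h(u* a v)`. -/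
def vectorFunctional (h : A →ₗ[ℂ] ℂ) (u v : A) : A →ₗ[ℂ] ℂ :=
  h ∘ₗ LinearMap.mulLeft ℂ (star u) ∘ₗ LinearMap.mulRight ℂ v

theorem vectorFunctional_apply (h : A →ₗ[ℂ] ℂ) (u v a : A) :
    vectorFunctional h u v a = h (star u * a * v) := by
  simp [vectorFunctional, mul_assoc]

/-- `(B, Δ_B)` is a quantum subgroup of `(A, Δ_A)` through `π : A → B`: `(B, Δ_B)` is a quantum
group and `π` is a surjective `*`-homomorphism with `Δ_B ∘ π = (π ⊗ π) ∘ Δ_A`. (Since `π` is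
surjective, `B` is finite-dimensional as soon as `A` is.) -/
structure IsQuantumSubgroup (ΔA : A →⋆ₐ[ℂ] A ⊗[ℂ] A) (ΔB : B →⋆ₐ[ℂ] B ⊗[ℂ] B)
    (π : A →⋆ₐ[ℂ] B) : Prop where
  isFiniteQuantumGroup : IsFiniteQuantumGroup ΔB
  surjective : Function.Surjective π
  comul_comp : ∀ a : A,
    ΔB (π a) = TensorProduct.map π.toAlgHom.toLinearMap π.toAlgHom.toLinearMap (ΔA a)

/-- A Haar idempotent state: a functional of the form `h_B ∘ π` for a quantum subgroup `B` with
morphism `π : A → B` and Haar state `h_B`. -/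
def IsHaarIdempotent (Δ : A →⋆ₐ[ℂ] A ⊗[ℂ] A) (φ : A →ₗ[ℂ] ℂ) : Prop :=
  ∃ (B : Type u) (_ : CStarAlgebra B) (ΔB : B →⋆ₐ[ℂ] B ⊗[ℂ] B) (π : A →⋆ₐ[ℂ] B)
    (hB : B →ₗ[ℂ] ℂ), IsQuantumSubgroup Δ ΔB π ∧ IsHaarState ΔB hB ∧
      φ = hB ∘ₗ π.toAlgHom.toLinearMap

/-- A right coidalgebra: a unital `*`-subalgebra `C` of `A` with `Δ(C) ⊆ A ⊗ C`. -/
structure IsRightCoidalgebra (Δ : A →⋆ₐ[ℂ] A ⊗[ℂ] A) (C : Submodule ℂ A) : Prop where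
  one_mem : (1 : A) ∈ C
  mul_mem : ∀ a ∈ C, ∀ b ∈ C, a * b ∈ C
  star_mem : ∀ a ∈ C, star a ∈ C
  comul_mem : ∀ a ∈ C, Δ a ∈ LinearMap.range (C.subtype.lTensor A)

/-- The coidalgebra `C_φ = T_φ(A)` of an idempotent state `φ`, where `T_φ = (id ⊗ φ) ∘ Δ`. -/
def coidalgebra (Δ : A →⋆ₐ[ℂ] A ⊗[ℂ] A) (φ : A →ₗ[ℂ] ℂ) : Submodule ℂ A :=
  LinearMap.range (sliceRight φ ∘ₗ Δ.toAlgHom.toLinearMap)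

/-- The quotient `A//B = {a | (id ⊗ π)(Δ a) = a ⊗ 1}` by a quantum subgroup `π : A → B`. -/
def quotientCoidalgebra (Δ : A →⋆ₐ[ℂ] A ⊗[ℂ] A) (π : A →⋆ₐ[ℂ] B) : Submodule ℂ A :=
  LinearMap.eqLocus (π.toAlgHom.toLinearMap.lTensor A ∘ₗ Δ.toAlgHom.toLinearMap)
    ((TensorProduct.mk ℂ A B).flip 1)

theorem mem_quotientCoidalgebra (Δ : A →⋆ₐ[ℂ] A ⊗[ℂ] A) (π : A →⋆ₐ[ℂ] B) (a : A) :
    a ∈ quotientCoidalgebra Δ π ↔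
      π.toAlgHom.toLinearMap.lTensor A (Δ a) = a ⊗ₜ[ℂ] (1 : B) := Iff.rfl

/-- A right coidalgebra is of quotient type if it equals `A//B` for a quantum subgroup `B`. -/
def IsQuotientType (Δ : A →⋆ₐ[ℂ] A ⊗[ℂ] A) (C : Submodule ℂ A) : Prop :=
  IsRightCoidalgebra Δ C ∧
    ∃ (B : Type u) (_ : CStarAlgebra B) (ΔB : B →⋆ₐ[ℂ] B ⊗[ℂ] B) (π : A →⋆ₐ[ℂ] B),
      IsQuantumSubgroup Δ ΔB π ∧ C = quotientCoidalgebra Δ π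

end FiniteQG

end

/-!
Everything rests on the multiplicative unitary `V(a ⊗ b) = Δ(a)(1 ⊗ b)` and on positivity of
product functionals on `A ⊗ A`.

*Counit.* The spanning hypotheses make `V` bijective, and Van Daele's formula `m V⁻¹(a ⊗ 1) = ε(a) 1`
defines the counit (`exists_linear_counit`); multiplicativity follows as the elements
`(c ⊗ 1) Δ(a)` span `A ⊗ A`.

*Haar state.* Let `τ` be the normalized trace of the left regular representation of `A`. It is a
faithful tracial state. Since `V (L_a ⊗ 1) V⁻¹ = L_{Δ(a)}`, taking traces gives `τ ⋆ τ = τ`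
(`convolution_regularTrace`). If `x = (τ ⊗ id) Δ(x)`, then `Δ(x) - 1 ⊗ x` is null for the faithful
functional `τ ⊗ τ`, so `Δ(x) = 1 ⊗ x` and `x` is a scalar by the counit identity. Hence `τ` is the
Haar state, which is therefore faithful and tracial; no antipode is needed.

*Idempotent states.* Let `T = (id ⊗ φ) Δ`, with range `C`. For `x ∈ C` the vector `Δ(x) - x ⊗ 1` is
null for `h ⊗ φ`, so by Cauchy–Schwarz `T(y x) = T(y) x` for every `y` (`convRight_mul`). Thus `C` is
a `*`-algebra, `T` is the `h`-orthogonal projection onto it, and `φ = ε ∘ T` is determined by `C`.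
Moreover `φ(y x) = φ(y) ε(x)` for `x ∈ C`.

*Pre-subgroups.* The density `ρ` of `φ` with respect to `h` lies in `C` and satisfies
`x ρ = ε(x) ρ` for `x ∈ C`; it is thus a positive multiple of a projection, and its positive square
root is `f_φ`. Conversely every pre-subgroup `f` implementing `φ` lies in `C` and satisfies
`x f = ε(x) f` for `x ∈ C`, which forces `f` to be selfadjoint and unique.

*The equivalence.* If `φ = h_B ∘ π`, then `C = A//B` by a direct computation, and conversely
`C = A//B` gives `φ = h_B ∘ π` because `C` determines `φ`. Haar states being traces, a Haar
idempotent has a central density, so `f_φ` is central. If `f_φ` is central, then `p = f_φ / ε(f_φ)`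
is a central projection with `Δ(p)(1 ⊗ p) = p ⊗ p`, the corner `p A` is a quantum subgroup, and the
restriction of `φ` to it is a state invariant on one side, hence its Haar state.
-/

noncomputable section

namespace FiniteQG

variable {A : Type u} [CStarAlgebra A] {B : Type u} [CStarAlgebra B]

/-! ### Positive functionals on `*`-algebras -/

section Positive

variable {R : Type*} [Ring R] [StarRing R] [Algebra ℂ R] [StarModule ℂ R]

/-- The null case of the Cauchy–Schwarz inequality: a vector that is null for a positive
functional is orthogonal to everything. -/
theorem map_star_mul_eq_zero_of_null {ψ : R →ₗ[ℂ] ℂ} (hψ : ∀ x, 0 ≤ ψ (star x * x)) {z : R}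
    (hz : ψ (star z * z) = 0) (y : R) : ψ (star y * z) = 0 := by
  have key : ∀ t : ℂ, star t * ψ (star z * y) + t * ψ (star y * z) = 0 := by
    intro t
    have exp : ∀ t : ℂ, ψ (star (t • z + y) * (t • z + y)) =
        star t * ψ (star z * y) + t * ψ (star y * z) + ψ (star y * y) := by
      intro t
      simp only [star_add, star_smul, add_mul, mul_add, smul_mul_assoc, mul_smul_comm, map_add,
        map_smul, smul_eq_mul, hz]
      ring
    have hy := hψ y
    -- positivity at `r t` for every real `r` leaves no room for the term linear in `r`
    have hr : ∀ r : ℝ, 0 ≤ (r : ℂ) * (star t * ψ (star z * y) + t * ψ (star y * z)) +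
        ψ (star y * y) := by
      intro r
      have := hψ (((r : ℂ) * t) • z + y)
      rw [exp] at this
      convert this using 1
      simp
      ring
    set s := star t * ψ (star z * y) + t * ψ (star y * z)
    set k := ψ (star y * y)
    simp only [Complex.le_def, Complex.add_re, Complex.add_im, Complex.mul_re, Complex.mul_im,
      Complex.ofReal_re, Complex.ofReal_im, Complex.zero_re, Complex.zero_im] at hr hy
    apply Complex.ext
    · by_contra hne
      have h1 := (hr (-(k.re + 1) / s.re)).1
      have hne' : s.re ≠ 0 := hne
      have : -(k.re + 1) / s.re * s.re = -(k.re + 1) := by field_simp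
      linarith
    · have h1 := (hr 1).2
      simp only [Complex.zero_im]
      linarith [hy.2]
  have h1 := key 1
  have h2 := key Complex.I
  simp only [star_one, one_mul, RCLike.star_def, Complex.conj_I] at h1 h2
  have h3 : ψ (star y * z) = ψ (star z * y) := by
    have : Complex.I * (ψ (star y * z) - ψ (star z * y)) = 0 := by linear_combination h2
    simpa [sub_eq_zero] using this
  rw [← h3] at h1
  simpa [← two_mul] using h1

theorem map_star_of_pos {ψ : R →ₗ[ℂ] ℂ} (hψ : ∀ x, 0 ≤ ψ (star x * x)) (a : R) :
    ψ (star a) = star (ψ a) := by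
  have exp : ∀ t : ℂ, ψ (star (t • a + 1) * (t • a + 1)) =
      star t * t * ψ (star a * a) + star t * ψ (star a) + t * ψ a + ψ 1 := by
    intro t
    simp only [star_add, star_smul, add_mul, mul_add, smul_mul_assoc, mul_smul_comm, map_add,
      map_smul, smul_eq_mul, star_one, mul_one, one_mul]
    ring
  have h0 : ψ 1 = ψ (star 1 * 1) := by rw [star_one, mul_one]
  have p0 := hψ 1
  have p1 := hψ a
  have p2 := hψ ((1 : ℂ) • a + 1)
  have p3 := hψ (Complex.I • a + 1)
  rw [exp] at p2 p3
  rw [← h0] at p0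
  simp [Complex.le_def] at p0 p1 p2 p3
  apply Complex.ext
  · simp
    linarith
  · simp
    linarith

end Positive

theorem IsState.map_star {φ : A →ₗ[ℂ] ℂ} (hφ : IsState φ) (a : A) :
    φ (star a) = star (φ a) :=
  map_star_of_pos hφ.1 a

/-- An orthonormal basis for a positive definite form on a space that carries no norm. -/
theorem exists_basis_core_orthonormal {V : Type*} [AddCommGroup V] [Module ℂ V]
    [FiniteDimensional ℂ V] (c : InnerProductSpace.Core ℂ V) :
    ∃ (n : ℕ) (e : Module.Basis (Fin n) ℂ V),
      ∀ i j, c.inner (e i) (e j) = if i = j then 1 else 0 := by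
  let : NormedAddCommGroup V := c.toNormedAddCommGroup
  let : InnerProductSpace ℂ V := InnerProductSpace.ofCore c.toCore
  refine ⟨_, (stdOrthonormalBasis ℂ V).toBasis, fun i j => ?_⟩
  have := orthonormal_iff_ite.mp (stdOrthonormalBasis ℂ V).orthonormal i j
  rw [OrthonormalBasis.coe_toBasis]
  exact this

/-- Faithfulness of a functional: `φ(a* a) = 0` only for `a = 0`. -/
def IsFaithful (φ : A →ₗ[ℂ] ℂ) : Prop :=
  ∀ a : A, φ (star a * a) = 0 → a = 0

/-- A faithful state on a finite-dimensional algebra has an orthonormal basis. -/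
theorem IsState.exists_orthonormal_basis [FiniteDimensional ℂ A] {h : A →ₗ[ℂ] ℂ}
    (hh : IsState h) (hf : IsFaithful h) :
    ∃ (n : ℕ) (e : Module.Basis (Fin n) ℂ A),
      ∀ i j, h (star (e i) * e j) = if i = j then 1 else 0 := by
  let c : InnerProductSpace.Core ℂ A :=
    { inner := fun x y => h (star x * y)
      conj_inner_symm := fun x y => by
        change star (h (star y * x)) = _
        rw [← hh.map_star, star_mul, star_star]
      re_inner_nonneg := fun x => (Complex.le_def.mp (hh.1 x)).1
      add_left := fun x y z => by simp [add_mul]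
      smul_left := fun x y r => by simp
      definite := fun x hx => hf x hx }
  exact exists_basis_core_orthonormal c

/-! ### Product functionals on `A ⊗ A` and slice maps -/

@[simp]
theorem sliceLeft_tmul (ψ : A →ₗ[ℂ] ℂ) (a b : A) : sliceLeft ψ (a ⊗ₜ b) = ψ a • b := by
  simp [sliceLeft]

@[simp]
theorem sliceRight_tmul (ψ : A →ₗ[ℂ] ℂ) (a b : A) : sliceRight ψ (a ⊗ₜ b) = ψ b • a := by
  simp [sliceRight]

/-- The product functional `φ ⊗ ψ` on `A ⊗ A`. -/
def prodFunctional (φ ψ : A →ₗ[ℂ] ℂ) : A ⊗[ℂ] A →ₗ[ℂ] ℂ :=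
  LinearMap.mul' ℂ ℂ ∘ₗ TensorProduct.map φ ψ

@[simp]
theorem prodFunctional_tmul (φ ψ : A →ₗ[ℂ] ℂ) (a b : A) :
    prodFunctional φ ψ (a ⊗ₜ b) = φ a * ψ b := by
  simp [prodFunctional]

theorem prodFunctional_eq_sliceRight (φ ψ : A →ₗ[ℂ] ℂ) (X : A ⊗[ℂ] A) :
    prodFunctional φ ψ X = φ (sliceRight ψ X) := by
  induction X with
  | zero => simp
  | add X Y hX hY => simp [hX, hY]
  | tmul a b => simp [mul_comm]

theorem prodFunctional_eq_sliceLeft (φ ψ : A →ₗ[ℂ] ℂ) (X : A ⊗[ℂ] A) :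
    prodFunctional φ ψ X = ψ (sliceLeft φ X) := by
  induction X with
  | zero => simp
  | add X Y hX hY => simp [hX, hY]
  | tmul a b => simp

theorem sliceRight_tmul_one_mul (ψ : A →ₗ[ℂ] ℂ) (c : A) (X : A ⊗[ℂ] A) :
    sliceRight ψ (c ⊗ₜ 1 * X) = c * sliceRight ψ X := by
  induction X with
  | zero => simp
  | add X Y hX hY => simp [mul_add, hX, hY]
  | tmul a b => simp

theorem sliceRight_mul_tmul_one (ψ : A →ₗ[ℂ] ℂ) (c : A) (X : A ⊗[ℂ] A) :
    sliceRight ψ (X * c ⊗ₜ 1) = sliceRight ψ X * c := by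
  induction X with
  | zero => simp
  | add X Y hX hY => simp [add_mul, hX, hY]
  | tmul a b => simp

theorem sliceLeft_one_tmul_mul (ψ : A →ₗ[ℂ] ℂ) (c : A) (X : A ⊗[ℂ] A) :
    sliceLeft ψ (1 ⊗ₜ c * X) = c * sliceLeft ψ X := by
  induction X with
  | zero => simp
  | add X Y hX hY => simp [mul_add, hX, hY]
  | tmul a b => simp

theorem sliceLeft_mul_one_tmul (ψ : A →ₗ[ℂ] ℂ) (c : A) (X : A ⊗[ℂ] A) :
    sliceLeft ψ (X * 1 ⊗ₜ c) = sliceLeft ψ X * c := by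
  induction X with
  | zero => simp
  | add X Y hX hY => simp [add_mul, hX, hY]
  | tmul a b => simp

theorem IsState.sliceRight_star {ψ : A →ₗ[ℂ] ℂ} (hψ : IsState ψ) (X : A ⊗[ℂ] A) :
    sliceRight ψ (star X) = star (sliceRight ψ X) := by
  induction X with
  | zero => simp
  | add X Y hX hY => simp [hX, hY]
  | tmul a b => simp [TensorProduct.star_tmul, hψ.map_star]

theorem IsState.sliceLeft_star {ψ : A →ₗ[ℂ] ℂ} (hψ : IsState ψ) (X : A ⊗[ℂ] A) :
    sliceLeft ψ (star X) = star (sliceLeft ψ X) := by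
  induction X with
  | zero => simp
  | add X Y hX hY => simp [hX, hY]
  | tmul a b => simp [TensorProduct.star_tmul, hψ.map_star]

/-- In an `h`-orthonormal basis of the first leg, `h ⊗ φ` becomes a sum of copies of `φ`. -/
theorem prodFunctional_star_mul_self {h : A →ₗ[ℂ] ℂ} {n : ℕ} (e : Fin n → A)
    (he : ∀ i j, h (star (e i) * e j) = if i = j then 1 else 0) (φ : A →ₗ[ℂ] ℂ) (b : Fin n → A) :
    prodFunctional h φ (star (∑ i, e i ⊗ₜ b i) * ∑ i, e i ⊗ₜ b i) =
      ∑ i, φ (star (b i) * b i) := by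
  simp [star_sum, Finset.sum_mul, Finset.mul_sum, TensorProduct.star_tmul, he]

theorem exists_sum_basis_tmul {n : ℕ} (e : Module.Basis (Fin n) ℂ A) (X : A ⊗[ℂ] A) :
    ∃ b : Fin n → A, X = ∑ i, e i ⊗ₜ[ℂ] b i := by
  induction X with
  | zero => exact ⟨0, by simp⟩
  | add X Y hX hY =>
    obtain ⟨b, rfl⟩ := hX
    obtain ⟨c, rfl⟩ := hY
    exact ⟨b + c, by simp [TensorProduct.tmul_add, Finset.sum_add_distrib]⟩
  | tmul x y =>
    refine ⟨fun i => e.repr x i • y, ?_⟩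
    simp only [← TensorProduct.smul_tmul, ← TensorProduct.sum_tmul, e.sum_repr]

theorem prodFunctional_nonneg [FiniteDimensional ℂ A] {h φ : A →ₗ[ℂ] ℂ} (hh : IsState h)
    (hf : IsFaithful h) (hφ : IsState φ) (Z : A ⊗[ℂ] A) :
    0 ≤ prodFunctional h φ (star Z * Z) := by
  obtain ⟨n, e, he⟩ := hh.exists_orthonormal_basis hf
  obtain ⟨b, rfl⟩ := exists_sum_basis_tmul e Z
  rw [prodFunctional_star_mul_self e he]
  exact Finset.sum_nonneg fun i _ => hφ.1 _

theorem prodFunctional_faithful [FiniteDimensional ℂ A] {h φ : A →ₗ[ℂ] ℂ} (hh : IsState h)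
    (hf : IsFaithful h) (hφ : IsState φ) (hφf : IsFaithful φ) {Z : A ⊗[ℂ] A}
    (hZ : prodFunctional h φ (star Z * Z) = 0) : Z = 0 := by
  obtain ⟨n, e, he⟩ := hh.exists_orthonormal_basis hf
  obtain ⟨b, rfl⟩ := exists_sum_basis_tmul e Z
  rw [prodFunctional_star_mul_self e he, Finset.sum_eq_zero_iff_of_nonneg fun i _ => hφ.1 _] at hZ
  exact Finset.sum_eq_zero fun i hi => by rw [hφf _ (hZ i hi), TensorProduct.tmul_zero]

/-! ### The normalized trace of the regular representation -/

/-- The normalized trace of left multiplication. -/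
def regularTrace (A : Type u) [CStarAlgebra A] : A →ₗ[ℂ] ℂ :=
  (Module.finrank ℂ A : ℂ)⁻¹ • (LinearMap.trace ℂ A ∘ₗ LinearMap.mul ℂ A)

theorem regularTrace_apply (a : A) : regularTrace A a =
    (Module.finrank ℂ A : ℂ)⁻¹ * LinearMap.trace ℂ A (LinearMap.mulLeft ℂ a) := rfl

theorem regularTrace_mul_comm (a b : A) : regularTrace A (a * b) = regularTrace A (b * a) := by
  rw [regularTrace_apply, regularTrace_apply, LinearMap.mulLeft_mul, LinearMap.mulLeft_mul,
    ← Module.End.mul_eq_comp, ← Module.End.mul_eq_comp, LinearMap.trace_mul_comm]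

section

variable [FiniteDimensional ℂ A]

theorem regularTrace_one [Nontrivial A] : regularTrace A 1 = 1 := by
  have : (Module.finrank ℂ A : ℂ) ≠ 0 := by exact_mod_cast Module.finrank_pos.ne'
  simp [regularTrace_apply, this]

theorem isRoot_charpoly_mulLeft_iff (x : A) (μ : ℂ) :
    (LinearMap.mulLeft ℂ x).charpoly.IsRoot μ ↔ μ ∈ spectrum ℂ x := by
  have hsub : algebraMap ℂ (Module.End ℂ A) μ - LinearMap.mulLeft ℂ x =
      LinearMap.mulLeft ℂ (algebraMap ℂ A μ - x) := by
    ext y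
    simp [sub_mul, Algebra.smul_def]
  rw [← Module.End.mem_spectrum_iff_isRoot_charpoly, spectrum.mem_iff, spectrum.mem_iff,
    not_iff_not, hsub]
  exact Algebra.lmul_isUnit_iff

theorem nonneg_of_mem_roots_charpoly {a : A} {μ : ℂ}
    (hμ : μ ∈ (LinearMap.mulLeft ℂ (star a * a)).charpoly.roots) : 0 ≤ μ := by
  let _ : PartialOrder A := CStarAlgebra.spectralOrder A
  have _ : StarOrderedRing A := CStarAlgebra.spectralOrderedRing A
  exact spectrum_nonneg_of_nonneg (star_mul_self_nonneg a)
    ((isRoot_charpoly_mulLeft_iff _ _).mp (Polynomial.isRoot_of_mem_roots hμ))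

theorem trace_mulLeft_star_mul_self_nonneg (a : A) :
    0 ≤ LinearMap.trace ℂ A (LinearMap.mulLeft ℂ (star a * a)) := by
  rw [Module.End.trace_eq_sum_roots_charpoly_of_splits (IsAlgClosed.splits _)]
  exact Multiset.sum_nonneg fun μ hμ => nonneg_of_mem_roots_charpoly hμ

theorem eq_zero_of_trace_mulLeft_star_mul_self {a : A}
    (ha : LinearMap.trace ℂ A (LinearMap.mulLeft ℂ (star a * a)) = 0) : a = 0 := by
  rw [Module.End.trace_eq_sum_roots_charpoly_of_splits (IsAlgClosed.splits _)] at ha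
  have hzero := Multiset.all_zero_of_le_zero_le_of_sum_eq_zero
    (fun μ hμ => nonneg_of_mem_roots_charpoly hμ) ha
  have hrad : spectralRadius ℂ (star a * a) = 0 := by
    refine le_antisymm (iSup₂_le fun μ hμ => ?_) zero_le
    have hroot := (isRoot_charpoly_mulLeft_iff (star a * a) μ).mpr hμ
    rw [hzero _ ((Polynomial.mem_roots (LinearMap.charpoly_monic _).ne_zero).mpr hroot)]
    simp
  rw [(IsSelfAdjoint.star_mul_self a).spectralRadius_eq_nnnorm] at hrad
  simpa using hrad

theorem isState_regularTrace [Nontrivial A] : IsState (regularTrace A) :=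
  ⟨fun a => mul_nonneg (by positivity) (trace_mulLeft_star_mul_self_nonneg a), regularTrace_one⟩

theorem isFaithful_regularTrace [Nontrivial A] : IsFaithful (regularTrace A) := by
  intro a ha
  have : (Module.finrank ℂ A : ℂ) ≠ 0 := by exact_mod_cast Module.finrank_pos.ne'
  rw [regularTrace_apply, mul_eq_zero, or_iff_right (inv_ne_zero this)] at ha
  exact eq_zero_of_trace_mulLeft_star_mul_self ha

end
/-! ### Coassociativity and convolution operators -/

variable {Δ : A →⋆ₐ[ℂ] A ⊗[ℂ] A}

/-- The operator `T_φ = (id ⊗ φ) ∘ Δ`. -/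
def convRight (Δ : A →⋆ₐ[ℂ] A ⊗[ℂ] A) (φ : A →ₗ[ℂ] ℂ) : A →ₗ[ℂ] A :=
  sliceRight φ ∘ₗ Δ.toAlgHom.toLinearMap

/-- The operator `(φ ⊗ id) ∘ Δ`. -/
def convLeft (Δ : A →⋆ₐ[ℂ] A ⊗[ℂ] A) (φ : A →ₗ[ℂ] ℂ) : A →ₗ[ℂ] A :=
  sliceLeft φ ∘ₗ Δ.toAlgHom.toLinearMap

theorem convRight_apply (φ : A →ₗ[ℂ] ℂ) (a : A) : convRight Δ φ a = sliceRight φ (Δ a) := rfl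

theorem convLeft_apply (φ : A →ₗ[ℂ] ℂ) (a : A) : convLeft Δ φ a = sliceLeft φ (Δ a) := rfl

theorem convolution_apply (φ ψ : A →ₗ[ℂ] ℂ) (a : A) :
    convolution Δ φ ψ a = prodFunctional φ ψ (Δ a) := rfl

theorem convolution_eq_convRight (φ ψ : A →ₗ[ℂ] ℂ) (a : A) :
    convolution Δ φ ψ a = φ (convRight Δ ψ a) := by
  rw [convolution_apply, prodFunctional_eq_sliceRight, convRight_apply]

theorem convolution_eq_convLeft (φ ψ : A →ₗ[ℂ] ℂ) (a : A) :
    convolution Δ φ ψ a = ψ (convLeft Δ φ a) := by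
  rw [convolution_apply, prodFunctional_eq_sliceLeft, convLeft_apply]

theorem convRight_star {φ : A →ₗ[ℂ] ℂ} (hφ : IsState φ) (a : A) :
    convRight Δ φ (star a) = star (convRight Δ φ a) := by
  rw [convRight_apply, convRight_apply, map_star, hφ.sliceRight_star]

theorem convLeft_star {φ : A →ₗ[ℂ] ℂ} (hφ : IsState φ) (a : A) :
    convLeft Δ φ (star a) = star (convLeft Δ φ a) := by
  rw [convLeft_apply, convLeft_apply, map_star, hφ.sliceLeft_star]

theorem convRight_one {φ : A →ₗ[ℂ] ℂ} (hφ : IsState φ) : convRight Δ φ 1 = 1 := by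
  simp [convRight_apply, Algebra.TensorProduct.one_def, hφ.2]

theorem IsFiniteQuantumGroup.comul_convRight (hΔ : IsFiniteQuantumGroup Δ) (φ : A →ₗ[ℂ] ℂ)
    (a : A) : Δ (convRight Δ φ a) = (convRight Δ φ).lTensor A (Δ a) := by
  have h1 : ∀ Z : A ⊗[ℂ] A, (convRight Δ φ).lTensor A Z =
      (sliceRight φ).lTensor A (Δ.toAlgHom.toLinearMap.lTensor A Z) := fun Z => by
    rw [convRight, LinearMap.lTensor_comp_apply]
  have h2 : ∀ (Z : A ⊗[ℂ] A) (y : A),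
      (sliceRight φ).lTensor A (TensorProduct.assoc ℂ A A A (Z ⊗ₜ y)) = φ y • Z := by
    intro Z y
    induction Z with
    | zero => simp
    | add X Y hX hY => simp only [TensorProduct.add_tmul, map_add, hX, hY, smul_add]
    | tmul p q => simp
  have h3 : ∀ Z : A ⊗[ℂ] A, (sliceRight φ).lTensor A
      (TensorProduct.assoc ℂ A A A (Δ.toAlgHom.toLinearMap.rTensor A Z)) =
        Δ (sliceRight φ Z) := by
    intro Z
    induction Z with
    | zero => simp
    | add X Y hX hY => simp only [map_add, hX, hY]
    | tmul p q =>
      rw [LinearMap.rTensor_tmul, h2, sliceRight_tmul, map_smul]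
      rfl
  rw [h1, ← hΔ.coassoc, h3, convRight_apply]

theorem IsFiniteQuantumGroup.comul_convLeft (hΔ : IsFiniteQuantumGroup Δ) (φ : A →ₗ[ℂ] ℂ)
    (a : A) : Δ (convLeft Δ φ a) = (convLeft Δ φ).rTensor A (Δ a) := by
  have h1 : ∀ (Z : A ⊗[ℂ] A) (y : A),
      ((TensorProduct.lid ℂ (A ⊗[ℂ] A)).toLinearMap ∘ₗ φ.rTensor (A ⊗[ℂ] A))
        (TensorProduct.assoc ℂ A A A (Z ⊗ₜ y)) = sliceLeft φ Z ⊗ₜ y := by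
    intro Z y
    induction Z with
    | zero => simp
    | add X Y hX hY => simp only [TensorProduct.add_tmul, map_add, hX, hY]
    | tmul p q => simp [TensorProduct.smul_tmul']
  have h2 : ∀ Z : A ⊗[ℂ] A,
      ((TensorProduct.lid ℂ (A ⊗[ℂ] A)).toLinearMap ∘ₗ φ.rTensor (A ⊗[ℂ] A))
        (TensorProduct.assoc ℂ A A A (Δ.toAlgHom.toLinearMap.rTensor A Z)) =
          (convLeft Δ φ).rTensor A Z := by
    intro Z
    induction Z with
    | zero => simp
    | add X Y hX hY => simp only [map_add, hX, hY]
    | tmul p q =>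
      rw [LinearMap.rTensor_tmul, h1]
      rfl
  have h3 : ∀ Z : A ⊗[ℂ] A,
      ((TensorProduct.lid ℂ (A ⊗[ℂ] A)).toLinearMap ∘ₗ φ.rTensor (A ⊗[ℂ] A))
        (Δ.toAlgHom.toLinearMap.lTensor A Z) = Δ (sliceLeft φ Z) := by
    intro Z
    induction Z with
    | zero => simp
    | add X Y hX hY => simp only [map_add, hX, hY]
    | tmul p q => simp
  rw [← h2, hΔ.coassoc, h3, convLeft_apply]

theorem sliceRight_lTensor (φ : A →ₗ[ℂ] ℂ) (T : A →ₗ[ℂ] A) (Z : A ⊗[ℂ] A) :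
    sliceRight φ (T.lTensor A Z) = sliceRight (φ ∘ₗ T) Z := by
  simp only [sliceRight, LinearMap.comp_apply, LinearMap.lTensor_comp_apply]

theorem sliceLeft_rTensor (φ : A →ₗ[ℂ] ℂ) (T : A →ₗ[ℂ] A) (Z : A ⊗[ℂ] A) :
    sliceLeft φ (T.rTensor A Z) = sliceLeft (φ ∘ₗ T) Z := by
  simp only [sliceLeft, LinearMap.comp_apply, LinearMap.rTensor_comp_apply]

theorem IsFiniteQuantumGroup.convRight_convRight (hΔ : IsFiniteQuantumGroup Δ)
    (φ ψ : A →ₗ[ℂ] ℂ) (a : A) :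
    convRight Δ φ (convRight Δ ψ a) = convRight Δ (convolution Δ φ ψ) a := by
  have : φ ∘ₗ convRight Δ ψ = convolution Δ φ ψ :=
    LinearMap.ext fun b => (convolution_eq_convRight φ ψ b).symm
  rw [convRight_apply φ, hΔ.comul_convRight, sliceRight_lTensor, this, convRight_apply]

theorem IsFiniteQuantumGroup.convLeft_convLeft (hΔ : IsFiniteQuantumGroup Δ)
    (φ ψ : A →ₗ[ℂ] ℂ) (a : A) :
    convLeft Δ ψ (convLeft Δ φ a) = convLeft Δ (convolution Δ φ ψ) a := by
  have : ψ ∘ₗ convLeft Δ φ = convolution Δ φ ψ :=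
    LinearMap.ext fun b => (convolution_eq_convLeft φ ψ b).symm
  rw [convLeft_apply ψ, hΔ.comul_convLeft, sliceLeft_rTensor, this, convLeft_apply]

/-! ### The counit -/

theorem multiplicativeUnitary_mul_one_tmul (X : A ⊗[ℂ] A) (b : A) :
    multiplicativeUnitary Δ (X * 1 ⊗ₜ b) = multiplicativeUnitary Δ X * 1 ⊗ₜ b := by
  induction X with
  | zero => simp
  | add X Y hX hY => simp only [add_mul, map_add, hX, hY]
  | tmul p q => simp [multiplicativeUnitary_tmul, mul_assoc]

theorem multiplicativeUnitary_tmul_one_mul (X : A ⊗[ℂ] A) (a : A) :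
    multiplicativeUnitary Δ (a ⊗ₜ 1 * X) = Δ a * multiplicativeUnitary Δ X := by
  induction X with
  | zero => simp
  | add X Y hX hY => simp only [mul_add, map_add, hX, hY]
  | tmul p q => simp [multiplicativeUnitary_tmul, mul_assoc]

theorem IsFiniteQuantumGroup.multiplicativeUnitary_bijective (hΔ : IsFiniteQuantumGroup Δ) :
    Function.Bijective (multiplicativeUnitary Δ) := by
  have := hΔ.finiteDimensional
  have hs : Function.Surjective (multiplicativeUnitary Δ) := by
    rw [← LinearMap.range_eq_top, eq_top_iff, ← hΔ.span_right, Submodule.span_le]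
    rintro _ ⟨a, b, rfl⟩
    exact ⟨b ⊗ₜ a, multiplicativeUnitary_tmul Δ b a⟩
  exact ⟨LinearMap.injective_iff_surjective.mpr hs, hs⟩

theorem IsFiniteQuantumGroup.span_tmul_one_mul (hΔ : IsFiniteQuantumGroup Δ) :
    Submodule.span ℂ {x : A ⊗[ℂ] A | ∃ c a : A, x = c ⊗ₜ[ℂ] 1 * Δ a} = ⊤ := by
  have h : (⊤ : Submodule ℂ (A ⊗[ℂ] A)) ≤
      (Submodule.span ℂ {x : A ⊗[ℂ] A | ∃ c a : A, x = c ⊗ₜ[ℂ] 1 * Δ a}).comap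
        (starLinearEquiv ℂ : A ⊗[ℂ] A ≃ₗ⋆[ℂ] A ⊗[ℂ] A).toLinearMap := by
    rw [← hΔ.span_left, Submodule.span_le]
    rintro _ ⟨a, b, rfl⟩
    refine Submodule.subset_span ⟨star a, star b, ?_⟩
    simp [TensorProduct.star_tmul, map_star]
  refine eq_top_iff.mpr fun x _ => ?_
  have := h (Submodule.mem_top : star x ∈ ⊤)
  simpa using this

/-- The pentagon-type identity `V₂₃ (Δ ⊗ id) = (Δ ⊗ id) V`, which is coassociativity. -/
theorem IsFiniteQuantumGroup.lTensor_multiplicativeUnitary (hΔ : IsFiniteQuantumGroup Δ)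
    (X : A ⊗[ℂ] A) :
    (multiplicativeUnitary Δ).lTensor A
      (TensorProduct.assoc ℂ A A A (Δ.toAlgHom.toLinearMap.rTensor A X)) =
    TensorProduct.assoc ℂ A A A
      (Δ.toAlgHom.toLinearMap.rTensor A (multiplicativeUnitary Δ X)) := by
  have h1 : ∀ (Z : A ⊗[ℂ] A) (q y : A), TensorProduct.assoc ℂ A A A (Z ⊗ₜ (q * y)) =
      TensorProduct.assoc ℂ A A A (Z ⊗ₜ q) * 1 ⊗ₜ (1 ⊗ₜ y) := by
    intro Z q y
    induction Z with
    | zero => simp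
    | add X Y hX hY => simp only [TensorProduct.add_tmul, map_add, hX, hY, add_mul]
    | tmul p q => simp
  have h2 : ∀ (Z : A ⊗[ℂ] A) (y : A),
      TensorProduct.assoc ℂ A A A (Δ.toAlgHom.toLinearMap.rTensor A (Z * 1 ⊗ₜ y)) =
      TensorProduct.assoc ℂ A A A (Δ.toAlgHom.toLinearMap.rTensor A Z) * 1 ⊗ₜ (1 ⊗ₜ y) := by
    intro Z y
    induction Z with
    | zero => simp
    | add X Y hX hY => simp only [map_add, hX, hY, add_mul]
    | tmul p q =>
      rw [Algebra.TensorProduct.tmul_mul_tmul, mul_one, LinearMap.rTensor_tmul, h1,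
        LinearMap.rTensor_tmul]
  have h3 : ∀ (Z : A ⊗[ℂ] A) (y : A),
      (multiplicativeUnitary Δ).lTensor A (TensorProduct.assoc ℂ A A A (Z ⊗ₜ y)) =
      Δ.toAlgHom.toLinearMap.lTensor A Z * 1 ⊗ₜ (1 ⊗ₜ y) := by
    intro Z y
    induction Z with
    | zero => simp
    | add X Y hX hY => simp only [TensorProduct.add_tmul, map_add, hX, hY, add_mul]
    | tmul p q => simp [multiplicativeUnitary_tmul]
  induction X with
  | zero => simp
  | add X Y hX hY => simp only [map_add, hX, hY]
  | tmul p q =>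
    rw [multiplicativeUnitary_tmul, h2, hΔ.coassoc, LinearMap.rTensor_tmul]
    exact h3 _ _

/-- Van Daele's construction: the linear functional `ε` determined by
`m V⁻¹ (a ⊗ 1) = ε(a) 1` satisfies both counit identities. -/
theorem IsFiniteQuantumGroup.exists_linear_counit (hΔ : IsFiniteQuantumGroup Δ) :
    ∃ ε : A →ₗ[ℂ] ℂ, ∀ a, sliceLeft ε (Δ a) = a ∧ sliceRight ε (Δ a) = a := by
  have := hΔ.finiteDimensional
  have := hΔ.nontrivial
  let V := LinearEquiv.ofBijective _ hΔ.multiplicativeUnitary_bijective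
  have hV : ∀ X, V X = multiplicativeUnitary Δ X := fun X => rfl
  let e : A →ₗ[ℂ] A :=
    LinearMap.mul' ℂ A ∘ₗ V.symm.toLinearMap ∘ₗ (TensorProduct.mk ℂ A A).flip 1
  have he : ∀ a, e a = LinearMap.mul' ℂ A (V.symm (a ⊗ₜ 1)) := fun a => rfl
  let E : A ⊗[ℂ] A →ₗ[ℂ] A := LinearMap.mul' ℂ A ∘ₗ e.rTensor A
  have hE_tmul : ∀ a b, E (a ⊗ₜ b) = e a * b := fun a b => by simp [E]
  have hm : ∀ (X : A ⊗[ℂ] A) (b : A),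
      LinearMap.mul' ℂ A (X * 1 ⊗ₜ b) = LinearMap.mul' ℂ A X * b := by
    intro X b
    induction X with
    | zero => simp
    | add X Y hX hY => simp only [add_mul, map_add, hX, hY]
    | tmul p q => simp [mul_assoc]
  have hE' : E = LinearMap.mul' ℂ A ∘ₗ V.symm.toLinearMap := by
    refine TensorProduct.ext' fun a b => ?_
    have : V.symm (a ⊗ₜ b) = V.symm (a ⊗ₜ 1) * 1 ⊗ₜ b := by
      rw [LinearEquiv.symm_apply_eq, hV, multiplicativeUnitary_mul_one_tmul, ← hV,
        LinearEquiv.apply_symm_apply]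
      simp
    rw [hE_tmul, he, ← hm, ← this]
    rfl
  have hEV : E ∘ₗ multiplicativeUnitary Δ = LinearMap.mul' ℂ A := by
    ext1
    rw [hE']
    ext p q
    simp [← hV]
  have h3 : ∀ X, (LinearMap.mul' ℂ A).lTensor A
      (TensorProduct.assoc ℂ A A A (Δ.toAlgHom.toLinearMap.rTensor A X)) =
        multiplicativeUnitary Δ X := by
    have h : ∀ (Z : A ⊗[ℂ] A) (y : A), (LinearMap.mul' ℂ A).lTensor A
        (TensorProduct.assoc ℂ A A A (Z ⊗ₜ y)) = Z * 1 ⊗ₜ y := by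
      intro Z y
      induction Z with
      | zero => simp
      | add X Y hX hY => simp only [TensorProduct.add_tmul, map_add, hX, hY, add_mul]
      | tmul p q => simp
    intro X
    induction X with
    | zero => simp
    | add X Y hX hY => simp only [map_add, hX, hY]
    | tmul p q => exact h _ _
  have h4 : ∀ Z : A ⊗[ℂ] A,
      E.lTensor A (TensorProduct.assoc ℂ A A A (Z ⊗ₜ 1)) = e.lTensor A Z := by
    intro Z
    induction Z with
    | zero => simp
    | add X Y hX hY => simp only [TensorProduct.add_tmul, map_add, hX, hY]
    | tmul p q => simp [hE_tmul]
  have h5 : ∀ a, e.lTensor A (Δ a) = a ⊗ₜ 1 := by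
    intro a
    have h := hΔ.lTensor_multiplicativeUnitary (V.symm (a ⊗ₜ 1))
    rw [← hV, LinearEquiv.apply_symm_apply] at h
    have h' := congrArg (E.lTensor A) h
    rw [← LinearMap.lTensor_comp_apply, hEV, h3, ← hV, LinearEquiv.apply_symm_apply] at h'
    rw [h', LinearMap.rTensor_tmul]
    exact (h4 (Δ a)).symm
  have h6 : ∀ (c : A) (Z : A ⊗[ℂ] A), e.lTensor A (c ⊗ₜ 1 * Z) = c ⊗ₜ 1 * e.lTensor A Z := by
    intro c Z
    induction Z with
    | zero => simp
    | add X Y hX hY => simp only [mul_add, map_add, hX, hY]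
    | tmul p q => simp
  have h7 : ∀ Y : A ⊗[ℂ] A,
      e.lTensor A Y ∈ LinearMap.range ((TensorProduct.mk ℂ A A).flip 1) := by
    have : (⊤ : Submodule ℂ (A ⊗[ℂ] A)) ≤
        (LinearMap.range ((TensorProduct.mk ℂ A A).flip 1)).comap (e.lTensor A) := by
      rw [← hΔ.span_tmul_one_mul, Submodule.span_le]
      rintro _ ⟨c, a, rfl⟩
      exact ⟨c * a, by simp [h6, h5]⟩
    exact fun Y => this Submodule.mem_top
  let τ := regularTrace A
  have hτ : τ 1 = 1 := regularTrace_one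
  have h8 : ∀ y, e y = τ (e y) • (1 : A) := by
    intro y
    obtain ⟨z, hz⟩ := h7 (1 ⊗ₜ y)
    have := congrArg (sliceLeft τ) hz
    simp only [LinearMap.flip_apply, TensorProduct.mk_apply, sliceLeft_tmul,
      LinearMap.lTensor_tmul, hτ, one_smul] at this
    rw [← this]
    simp [hτ]
  refine ⟨τ ∘ₗ e, fun a => ⟨?_, ?_⟩⟩
  · have h := LinearMap.congr_fun hEV (a ⊗ₜ 1)
    have hE : E = sliceLeft (τ ∘ₗ e) := by
      refine TensorProduct.ext' fun p q => ?_
      rw [hE_tmul, h8 p]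
      simp
    rw [hE] at h
    simpa [multiplicativeUnitary_tmul, ← Algebra.TensorProduct.one_def] using h
  · rw [← sliceRight_lTensor, h5]
    simp [hτ]

/-- A linear functional satisfying the counit identity on the right leg is multiplicative, since
the elements `(c ⊗ 1) Δ(a)` span `A ⊗ A`. -/
theorem IsFiniteQuantumGroup.linear_counit_mul (hΔ : IsFiniteQuantumGroup Δ) {ε : A →ₗ[ℂ] ℂ}
    (hε : ∀ a, sliceRight ε (Δ a) = a) (q r : A) : ε (q * r) = ε q * ε r := by
  have := hΔ.nontrivial
  have h1 : ∀ (X : A ⊗[ℂ] A) (b : A), sliceRight ε (X * Δ b) = sliceRight ε X * b := by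
    intro X b
    have : sliceRight ε ∘ₗ LinearMap.mulRight ℂ (Δ b) =
        LinearMap.mulRight ℂ b ∘ₗ sliceRight ε := by
      refine LinearMap.ext_on hΔ.span_tmul_one_mul ?_
      rintro _ ⟨c, a, rfl⟩
      simp only [LinearMap.comp_apply, LinearMap.mulRight_apply]
      rw [mul_assoc, ← map_mul, sliceRight_tmul_one_mul, sliceRight_tmul_one_mul, hε, hε,
        mul_assoc]
    exact LinearMap.congr_fun this X
  have h2 : ∀ Y : A ⊗[ℂ] A, sliceRight ε (1 ⊗ₜ q * Y) = ε q • sliceRight ε Y := by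
    intro Y
    have : sliceRight ε ∘ₗ LinearMap.mulLeft ℂ (1 ⊗ₜ q) = ε q • sliceRight ε := by
      refine LinearMap.ext_on hΔ.span_tmul_one_mul ?_
      rintro _ ⟨c, a, rfl⟩
      simp only [LinearMap.comp_apply, LinearMap.mulLeft_apply, LinearMap.smul_apply]
      rw [← mul_assoc, Algebra.TensorProduct.tmul_mul_tmul, one_mul, mul_one,
        h1, sliceRight_tmul, sliceRight_tmul_one_mul, hε, smul_mul_assoc]
    exact LinearMap.congr_fun this Y
  have h3 := h2 (1 ⊗ₜ r)
  simp only [Algebra.TensorProduct.tmul_mul_tmul, sliceRight_tmul, one_mul, smul_smul] at h3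
  exact smul_left_injective ℂ (one_ne_zero' A) h3

theorem IsFiniteQuantumGroup.exists_counit (hΔ : IsFiniteQuantumGroup Δ) :
    ∃ ε : A →ₐ[ℂ] ℂ, IsCounit Δ ε := by
  have := hΔ.nontrivial
  obtain ⟨ε, hε⟩ := hΔ.exists_linear_counit
  have h1 : ε 1 = 1 := by
    have := (hε 1).2
    rw [map_one, Algebra.TensorProduct.one_def, sliceRight_tmul] at this
    exact smul_left_injective ℂ (one_ne_zero' A) (this.trans (one_smul ℂ (1 : A)).symm)
  exact ⟨AlgHom.ofLinearMap ε h1 (hΔ.linear_counit_mul fun a => (hε a).2), hε⟩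

theorem IsCounit.unique {ε ε' : A →ₐ[ℂ] ℂ} (h : IsCounit Δ ε) (h' : IsCounit Δ ε') : ε = ε' := by
  ext a
  have h1 := prodFunctional_eq_sliceRight ε.toLinearMap ε'.toLinearMap (Δ a)
  rw [prodFunctional_eq_sliceLeft, (h a).1, (h' a).2] at h1
  exact h1.symm

/-! ### The Haar state -/

/-- The multiplicative unitary conjugates `L_a ⊗ 1` to left multiplication by `Δ(a)`, so the trace
of the regular representation is idempotent up to normalization. -/
theorem IsFiniteQuantumGroup.convolution_regularTrace (hΔ : IsFiniteQuantumGroup Δ) :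
    convolution Δ (regularTrace A) (regularTrace A) = regularTrace A := by
  have := hΔ.finiteDimensional
  have := hΔ.nontrivial
  have hd : (Module.finrank ℂ A : ℂ) ≠ 0 := by exact_mod_cast Module.finrank_pos.ne'
  have htr : ∀ Z : A ⊗[ℂ] A, LinearMap.trace ℂ _ (LinearMap.mulLeft ℂ Z) =
      (Module.finrank ℂ A : ℂ) ^ 2 * prodFunctional (regularTrace A) (regularTrace A) Z := by
    intro Z
    induction Z with
    | zero => simp
    | add X Y hX hY =>
      have : LinearMap.mulLeft ℂ (X + Y) = LinearMap.mulLeft ℂ X + LinearMap.mulLeft ℂ Y := by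
        exact LinearMap.ext fun W => add_mul X Y W
      rw [this, map_add, hX, hY, map_add, mul_add]
    | tmul a b =>
      have : LinearMap.mulLeft ℂ (a ⊗ₜ[ℂ] b) =
          TensorProduct.map (LinearMap.mulLeft ℂ a) (LinearMap.mulLeft ℂ b) := by
        ext; simp
      rw [this, LinearMap.trace_tensorProduct', prodFunctional_tmul, regularTrace_apply,
        regularTrace_apply]
      field_simp
  ext a
  let V := LinearEquiv.ofBijective _ hΔ.multiplicativeUnitary_bijective
  have hconj : V.conj (LinearMap.mulLeft ℂ (a ⊗ₜ 1)) = LinearMap.mulLeft ℂ (Δ a) := by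
    refine LinearMap.ext fun X => ?_
    obtain ⟨Y, rfl⟩ := V.surjective X
    rw [LinearEquiv.conj_apply_apply, LinearEquiv.symm_apply_apply]
    exact multiplicativeUnitary_tmul_one_mul Y a
  have h := LinearMap.trace_conj' (LinearMap.mulLeft ℂ (a ⊗ₜ[ℂ] (1 : A))) V
  rw [hconj, htr, htr, prodFunctional_tmul, regularTrace_one, mul_one] at h
  exact mul_left_cancel₀ (pow_ne_zero 2 hd) h

/-- For a functional `h` invariant under `T_φ`, a fixed point `x` of `T_φ` satisfies
`Δ(x) = x ⊗ 1` up to a null vector of `h ⊗ φ`. -/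
theorem prodFunctional_comul_sub_tmul_one {h φ : A →ₗ[ℂ] ℂ} (hφ : IsState φ)
    (hh : ∀ a, h (convRight Δ φ a) = h a) {x : A} (hx : convRight Δ φ x = x) :
    prodFunctional h φ (star (Δ x - x ⊗ₜ 1) * (Δ x - x ⊗ₜ 1)) = 0 := by
  have h1 : prodFunctional h φ (star (Δ x) * Δ x) = h (star x * x) := by
    rw [prodFunctional_eq_sliceRight, ← map_star, ← map_mul, ← convRight_apply, hh]
  have h2 : prodFunctional h φ (star (Δ x) * x ⊗ₜ 1) = h (star x * x) := by
    rw [prodFunctional_eq_sliceRight, ← map_star, sliceRight_mul_tmul_one, ← convRight_apply,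
      convRight_star hφ, hx]
  have h3 : prodFunctional h φ (star x ⊗ₜ 1 * Δ x) = h (star x * x) := by
    rw [prodFunctional_eq_sliceRight, sliceRight_tmul_one_mul, ← convRight_apply, hx]
  simp only [star_sub, sub_mul, mul_sub, map_sub, h1, h2, TensorProduct.star_tmul, star_one, h3]
  simp [hφ.2]

theorem prodFunctional_comul_sub_one_tmul {h φ : A →ₗ[ℂ] ℂ} (hφ : IsState φ)
    (hh : ∀ a, h (convLeft Δ φ a) = h a) {x : A} (hx : convLeft Δ φ x = x) :
    prodFunctional φ h (star (Δ x - 1 ⊗ₜ x) * (Δ x - 1 ⊗ₜ x)) = 0 := by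
  have h1 : prodFunctional φ h (star (Δ x) * Δ x) = h (star x * x) := by
    rw [prodFunctional_eq_sliceLeft, ← map_star, ← map_mul, ← convLeft_apply, hh]
  have h2 : prodFunctional φ h (star (Δ x) * 1 ⊗ₜ x) = h (star x * x) := by
    rw [prodFunctional_eq_sliceLeft, ← map_star, sliceLeft_mul_one_tmul, ← convLeft_apply,
      convLeft_star hφ, hx]
  have h3 : prodFunctional φ h (1 ⊗ₜ star x * Δ x) = h (star x * x) := by
    rw [prodFunctional_eq_sliceLeft, sliceLeft_one_tmul_mul, ← convLeft_apply, hx]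
  simp only [star_sub, sub_mul, mul_sub, map_sub, h1, h2, TensorProduct.star_tmul, star_one, h3]
  simp [hφ.2]

/-- A faithful idempotent state is invariant. -/
theorem IsFiniteQuantumGroup.isHaarState_of_faithful (hΔ : IsFiniteQuantumGroup Δ)
    {τ : A →ₗ[ℂ] ℂ} (hτ : IsIdempotentState Δ τ) (hf : IsFaithful τ) : IsHaarState Δ τ := by
  have := hΔ.finiteDimensional
  obtain ⟨ε, hε⟩ := hΔ.exists_counit
  have hR : ∀ a, τ (convRight Δ τ a) = τ a := fun a => by
    rw [← convolution_eq_convRight, hτ.2]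
  have hL : ∀ a, τ (convLeft Δ τ a) = τ a := fun a => by
    rw [← convolution_eq_convLeft, hτ.2]
  refine ⟨hτ.1, fun a => ⟨?_, ?_⟩⟩
  · have hfix : convRight Δ τ (convRight Δ τ a) = convRight Δ τ a := by
      rw [hΔ.convRight_convRight, hτ.2]
    have h0 := prodFunctional_faithful hτ.1 hf hτ.1 hf
      (prodFunctional_comul_sub_tmul_one hτ.1 hR hfix)
    have h1 := (hε (convRight Δ τ a)).1
    rw [sub_eq_zero.mp h0, sliceLeft_tmul] at h1
    have h2 := congrArg τ h1
    rw [map_smul, hτ.1.2, hR, smul_eq_mul, mul_one] at h2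
    rw [← convRight_apply, ← h1, h2]
  · have hfix : convLeft Δ τ (convLeft Δ τ a) = convLeft Δ τ a := by
      rw [hΔ.convLeft_convLeft, hτ.2]
    have h0 := prodFunctional_faithful hτ.1 hf hτ.1 hf
      (prodFunctional_comul_sub_one_tmul hτ.1 hL hfix)
    have h1 := (hε (convLeft Δ τ a)).2
    rw [sub_eq_zero.mp h0, sliceRight_tmul] at h1
    have h2 := congrArg τ h1
    rw [map_smul, hτ.1.2, hL, smul_eq_mul, mul_one] at h2
    rw [← convLeft_apply, ← h1, h2]

theorem IsFiniteQuantumGroup.isHaarState_regularTrace (hΔ : IsFiniteQuantumGroup Δ) :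
    IsHaarState Δ (regularTrace A) := by
  have := hΔ.finiteDimensional
  have := hΔ.nontrivial
  exact hΔ.isHaarState_of_faithful ⟨isState_regularTrace, hΔ.convolution_regularTrace⟩
    isFaithful_regularTrace

/-- A state invariant on the right leg coincides with any state invariant on the left leg. -/
theorem eq_of_invariant {h h' : A →ₗ[ℂ] ℂ} (hs : IsState h) (hs' : IsState h')
    (hR : ∀ a, sliceRight h (Δ a) = h a • (1 : A))
    (hL : ∀ a, sliceLeft h' (Δ a) = h' a • (1 : A)) : h = h' := by
  ext a
  have h1 := prodFunctional_eq_sliceRight h' h (Δ a)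
  rw [prodFunctional_eq_sliceLeft, hL, hR, map_smul, map_smul, hs.2, hs'.2] at h1
  simpa using h1.symm

theorem IsFiniteQuantumGroup.eq_regularTrace (hΔ : IsFiniteQuantumGroup Δ) {h : A →ₗ[ℂ] ℂ}
    (hh : IsHaarState Δ h) : h = regularTrace A :=
  eq_of_invariant hh.1 hΔ.isHaarState_regularTrace.1 (fun a => (hh.2 a).1)
    fun a => (hΔ.isHaarState_regularTrace.2 a).2

/-! ### The conditional expectation of an idempotent state -/

theorem IsFiniteQuantumGroup.isFaithful_haar (hΔ : IsFiniteQuantumGroup Δ) {h : A →ₗ[ℂ] ℂ}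
    (hh : IsHaarState Δ h) : IsFaithful h := by
  have := hΔ.finiteDimensional
  have := hΔ.nontrivial
  rw [hΔ.eq_regularTrace hh]
  exact isFaithful_regularTrace

theorem IsFiniteQuantumGroup.haar_mul_comm (hΔ : IsFiniteQuantumGroup Δ) {h : A →ₗ[ℂ] ℂ}
    (hh : IsHaarState Δ h) (a b : A) : h (a * b) = h (b * a) := by
  rw [hΔ.eq_regularTrace hh, regularTrace_mul_comm]

theorem IsFaithful.eq_of_forall_mul_left {h : A →ₗ[ℂ] ℂ} (hf : IsFaithful h) {a b : A}
    (hab : ∀ c, h (c * a) = h (c * b)) : a = b := by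
  refine sub_eq_zero.mp (hf _ ?_)
  rw [mul_sub, map_sub, hab, sub_self]

theorem IsHaarState.haar_convRight {h φ : A →ₗ[ℂ] ℂ} (hh : IsHaarState Δ h) (hφ : IsState φ)
    (a : A) : h (convRight Δ φ a) = h a := by
  rw [convRight_apply, ← prodFunctional_eq_sliceRight, prodFunctional_eq_sliceLeft, (hh.2 a).2,
    map_smul, hφ.2, smul_eq_mul, mul_one]

theorem IsCounit.counit_convRight {ε : A →ₐ[ℂ] ℂ} (hε : IsCounit Δ ε) (φ : A →ₗ[ℂ] ℂ) (a : A) :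
    ε (convRight Δ φ a) = φ a := by
  have h := prodFunctional_eq_sliceRight ε.toLinearMap φ (Δ a)
  rw [prodFunctional_eq_sliceLeft, (hε a).1] at h
  exact h.symm

section IdempotentState

variable {h φ : A →ₗ[ℂ] ℂ} {ε : A →ₐ[ℂ] ℂ}

theorem IsFiniteQuantumGroup.mem_coidalgebra_iff (hΔ : IsFiniteQuantumGroup Δ)
    (hφ : IsIdempotentState Δ φ) {x : A} : x ∈ coidalgebra Δ φ ↔ convRight Δ φ x = x := by
  constructor
  · rintro ⟨a, rfl⟩
    change convRight Δ φ (convRight Δ φ a) = convRight Δ φ a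
    rw [hΔ.convRight_convRight, hφ.2]
  · exact fun hx => ⟨x, hx⟩

theorem convRight_mem_coidalgebra (Δ : A →⋆ₐ[ℂ] A ⊗[ℂ] A) (φ : A →ₗ[ℂ] ℂ) (a : A) :
    convRight Δ φ a ∈ coidalgebra Δ φ := ⟨a, rfl⟩

/-- The fixed points of `T_φ` lie in its multiplicative domain, because `Δ(x) - x ⊗ 1` is null
for `h ⊗ φ`. -/
theorem IsFiniteQuantumGroup.convRight_mul (hΔ : IsFiniteQuantumGroup Δ)
    (hφ : IsIdempotentState Δ φ) {x : A} (hx : x ∈ coidalgebra Δ φ) (y : A) :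
    convRight Δ φ (y * x) = convRight Δ φ y * x := by
  have := hΔ.finiteDimensional
  have hh := hΔ.isHaarState_regularTrace
  have hf := hΔ.isFaithful_haar hh
  have hnull := prodFunctional_comul_sub_tmul_one hφ.1 (hh.haar_convRight hφ.1)
    ((hΔ.mem_coidalgebra_iff hφ).mp hx)
  refine hf.eq_of_forall_mul_left fun b => ?_
  have key := map_star_mul_eq_zero_of_null (prodFunctional_nonneg hh.1 hf hφ.1) hnull
    (star (b ⊗ₜ 1 * Δ y))
  rwa [star_star, mul_sub, map_sub, sub_eq_zero, mul_assoc, ← map_mul, mul_assoc,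
    prodFunctional_eq_sliceRight, prodFunctional_eq_sliceRight, sliceRight_tmul_one_mul,
    sliceRight_tmul_one_mul, sliceRight_mul_tmul_one] at key

theorem IsFiniteQuantumGroup.star_mem_coidalgebra (hΔ : IsFiniteQuantumGroup Δ)
    (hφ : IsIdempotentState Δ φ) {x : A} (hx : x ∈ coidalgebra Δ φ) :
    star x ∈ coidalgebra Δ φ := by
  rw [hΔ.mem_coidalgebra_iff hφ] at hx ⊢
  rw [convRight_star hφ.1, hx]

theorem IsFiniteQuantumGroup.mul_convRight (hΔ : IsFiniteQuantumGroup Δ)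
    (hφ : IsIdempotentState Δ φ) {x : A} (hx : x ∈ coidalgebra Δ φ) (y : A) :
    convRight Δ φ (x * y) = x * convRight Δ φ y := by
  have h := hΔ.convRight_mul hφ (hΔ.star_mem_coidalgebra hφ hx) (star y)
  rw [← star_mul, convRight_star hφ.1, convRight_star hφ.1, ← star_mul] at h
  exact star_injective h

theorem IsFiniteQuantumGroup.isRightCoidalgebra_coidalgebra (hΔ : IsFiniteQuantumGroup Δ)
    (hφ : IsIdempotentState Δ φ) : IsRightCoidalgebra Δ (coidalgebra Δ φ) where
  one_mem := ⟨1, convRight_one hφ.1⟩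
  mul_mem a ha b hb := by
    rw [hΔ.mem_coidalgebra_iff hφ, hΔ.convRight_mul hφ hb, (hΔ.mem_coidalgebra_iff hφ).mp ha]
  star_mem a ha := hΔ.star_mem_coidalgebra hφ ha
  comul_mem a ha := by
    rw [← (hΔ.mem_coidalgebra_iff hφ).mp ha, hΔ.comul_convRight]
    refine ⟨((convRight Δ φ).codRestrict (coidalgebra Δ φ)
      (convRight_mem_coidalgebra Δ φ)).lTensor A (Δ a), ?_⟩
    rw [← LinearMap.lTensor_comp_apply, LinearMap.subtype_comp_codRestrict]

/-- On the coidalgebra an idempotent state restricts to the counit, hence is multiplicative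
against it. -/
theorem IsFiniteQuantumGroup.map_mul_of_mem (hΔ : IsFiniteQuantumGroup Δ)
    (hε : IsCounit Δ ε) (hφ : IsIdempotentState Δ φ) {x : A} (hx : x ∈ coidalgebra Δ φ) (y : A) :
    φ (y * x) = φ y * ε x := by
  rw [← hε.counit_convRight, hΔ.convRight_mul hφ hx, map_mul, hε.counit_convRight]

/-- `T_φ` is symmetric for the Haar state. -/
theorem IsFiniteQuantumGroup.haar_convRight_mul (hΔ : IsFiniteQuantumGroup Δ)
    (hh : IsHaarState Δ h) (hφ : IsIdempotentState Δ φ) (a b : A) :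
    h (convRight Δ φ a * b) = h (a * convRight Δ φ b) := by
  rw [← hh.haar_convRight hφ.1 (convRight Δ φ a * b),
    hΔ.mul_convRight hφ (convRight_mem_coidalgebra Δ φ a),
    ← hΔ.convRight_mul hφ (convRight_mem_coidalgebra Δ φ b), hh.haar_convRight hφ.1]

/-- An idempotent state is determined by its coidalgebra, as `T_φ` is the `h`-orthogonal
projection onto it. -/
theorem IsFiniteQuantumGroup.eq_of_coidalgebra_eq (hΔ : IsFiniteQuantumGroup Δ)
    (hφ : IsIdempotentState Δ φ) {ψ : A →ₗ[ℂ] ℂ} (hψ : IsIdempotentState Δ ψ)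
    (hC : coidalgebra Δ φ = coidalgebra Δ ψ) : φ = ψ := by
  obtain ⟨ε, hε⟩ := hΔ.exists_counit
  have hh := hΔ.isHaarState_regularTrace
  have hT : ∀ a, convRight Δ φ a = convRight Δ ψ a := by
    intro a
    have h1 : ∀ c, convRight Δ ψ (convRight Δ φ c) = convRight Δ φ c := fun c =>
      (hΔ.mem_coidalgebra_iff hψ).mp (hC ▸ convRight_mem_coidalgebra Δ φ c)
    have h2 : ∀ c, convRight Δ φ (convRight Δ ψ c) = convRight Δ ψ c := fun c =>
      (hΔ.mem_coidalgebra_iff hφ).mp (hC ▸ convRight_mem_coidalgebra Δ ψ c)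
    refine (hΔ.isFaithful_haar hh).eq_of_forall_mul_left fun c => ?_
    rw [← h1 a, ← hΔ.haar_convRight_mul hh hψ, ← hΔ.haar_convRight_mul hh hφ, h2,
      hΔ.haar_convRight_mul hh hψ]
  ext a
  rw [← hε.counit_convRight, hT, hε.counit_convRight]

/-! ### Pre-subgroups -/

theorem IsFiniteQuantumGroup.exists_density (hΔ : IsFiniteQuantumGroup Δ)
    (hh : IsHaarState Δ h) (φ : A →ₗ[ℂ] ℂ) : ∃ ρ : A, ∀ a, φ a = h (a * ρ) := by
  have := hΔ.finiteDimensional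
  let F : A →ₗ[ℂ] Module.Dual ℂ A := ((LinearMap.mul ℂ A).compr₂ h).flip
  have hF : Function.Injective F := fun a b hab =>
    (hΔ.isFaithful_haar hh).eq_of_forall_mul_left fun c => LinearMap.congr_fun hab c
  obtain ⟨ρ, hρ⟩ := (LinearMap.injective_iff_surjective_of_finrank_eq_finrank
    Subspace.dual_finrank_eq.symm).mp hF φ
  exact ⟨ρ, fun a => by rw [← hρ]; rfl⟩

theorem star_counit (ε : A →ₐ[ℂ] ℂ) (a : A) : ε (star a) = star (ε a) := map_star ε a

/-- A vector implementing `φ` is an eigenvector of left multiplication by the coidalgebra, with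
the counit as eigenvalue. -/
theorem IsFiniteQuantumGroup.mul_eq_counit_smul (hΔ : IsFiniteQuantumGroup Δ)
    (hε : IsCounit Δ ε) (hh : IsHaarState Δ h) (hφ : IsIdempotentState Δ φ) {f : A}
    (hf : vectorFunctional h f f = φ) {x : A} (hx : x ∈ coidalgebra Δ φ) : x * f = ε x • f := by
  have hC := hΔ.isRightCoidalgebra_coidalgebra hφ
  have hy : x - ε x • 1 ∈ coidalgebra Δ φ :=
    sub_mem hx (Submodule.smul_mem _ _ hC.one_mem)
  have h0 : φ (star (x - ε x • 1) * (x - ε x • 1)) = 0 := by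
    rw [hΔ.map_mul_of_mem hε hφ hy]
    simp
  rw [← hf, vectorFunctional_apply] at h0
  have h1 : (x - ε x • 1) * f = 0 := by
    refine hΔ.isFaithful_haar hh _ ?_
    rw [star_mul, ← h0]
    simp only [mul_assoc]
  simpa [sub_mul, sub_eq_zero] using h1

theorem IsPreSubgroup.mem_coidalgebra {f : A} (hp : IsPreSubgroup Δ ε h f)
    (hf : vectorFunctional h f f = φ) : f ∈ coidalgebra Δ φ := by
  refine ⟨f, ?_⟩
  have h1 : ∀ X : A ⊗[ℂ] A,
      sliceRight φ X = sliceRight (h ∘ₗ LinearMap.mulLeft ℂ (star f)) (X * 1 ⊗ₜ f) := by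
    intro X
    induction X with
    | zero => simp
    | add X Y hX hY => simp only [add_mul, map_add, hX, hY]
    | tmul a b => simp [← hf, vectorFunctional_apply, mul_assoc]
  change sliceRight φ (Δ f) = f
  rw [h1, ← multiplicativeUnitary_tmul, hp.fixed, sliceRight_tmul]
  simp [hp.norm_eq_one]

/-- A pre-subgroup implementing `φ` is a positive multiple of a projection. -/
theorem IsFiniteQuantumGroup.preSubgroup_star_eq (hΔ : IsFiniteQuantumGroup Δ)
    (hε : IsCounit Δ ε) (hh : IsHaarState Δ h) (hφ : IsIdempotentState Δ φ) {f : A}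
    (hp : IsPreSubgroup Δ ε h f) (hf : vectorFunctional h f f = φ) : star f = f := by
  have h1 := hΔ.mul_eq_counit_smul hε hh hφ hf
    (hΔ.star_mem_coidalgebra hφ (hp.mem_coidalgebra hf))
  have hreal : star (ε f) = ε f := (IsSelfAdjoint.of_nonneg hp.counit_pos.le).star_eq
  rw [star_counit, hreal] at h1
  have h2 := congrArg star h1
  rw [star_mul, star_star, h1, star_smul, hreal] at h2
  exact (smul_right_injective A hp.counit_pos.ne' h2).symm

theorem IsFiniteQuantumGroup.preSubgroup_mul_eq (hΔ : IsFiniteQuantumGroup Δ)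
    (hε : IsCounit Δ ε) (hh : IsHaarState Δ h) (hφ : IsIdempotentState Δ φ) {f : A}
    (hp : IsPreSubgroup Δ ε h f) (hf : vectorFunctional h f f = φ) : f * f = ε f • f :=
  hΔ.mul_eq_counit_smul hε hh hφ hf (hp.mem_coidalgebra hf)

theorem IsFiniteQuantumGroup.preSubgroup_unique (hΔ : IsFiniteQuantumGroup Δ)
    (hε : IsCounit Δ ε) (hh : IsHaarState Δ h) (hφ : IsIdempotentState Δ φ) {f g : A}
    (hp : IsPreSubgroup Δ ε h f) (hf : vectorFunctional h f f = φ)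
    (hq : IsPreSubgroup Δ ε h g) (hg : vectorFunctional h g g = φ) : f = g := by
  have sf := hΔ.preSubgroup_star_eq hε hh hφ hp hf
  have sg := hΔ.preSubgroup_star_eq hε hh hφ hq hg
  have h1 := hΔ.mul_eq_counit_smul hε hh hφ hg (hp.mem_coidalgebra hf)
  have h2 := hΔ.mul_eq_counit_smul hε hh hφ hf (hq.mem_coidalgebra hg)
  have hreal : star (ε f) = ε f := (IsSelfAdjoint.of_nonneg hp.counit_pos.le).star_eq
  have h3 := congrArg star h1
  rw [star_mul, sf, sg, h2, star_smul, sg, hreal] at h3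
  -- `ε(g) f = ε(f) g`, and the counits agree because both vectors are normalized
  have nf := hp.norm_eq_one
  have ng := hq.norm_eq_one
  rw [sf, hΔ.preSubgroup_mul_eq hε hh hφ hp hf, map_smul, smul_eq_mul] at nf
  rw [sg, hΔ.preSubgroup_mul_eq hε hh hφ hq hg, map_smul, smul_eq_mul] at ng
  have h4 := congrArg h h3
  simp only [map_smul, smul_eq_mul] at h4
  have h5 : ε f ^ 2 = ε g ^ 2 := by
    have hne := hp.counit_pos.ne'
    have hne' := hq.counit_pos.ne'
    have e1 : h f = (ε f)⁻¹ := eq_inv_of_mul_eq_one_right nf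
    have e2 : h g = (ε g)⁻¹ := eq_inv_of_mul_eq_one_right ng
    rw [e1, e2] at h4
    field_simp at h4
    exact h4.symm
  have h6 : ε f = ε g := by
    rcases sq_eq_sq_iff_eq_or_eq_neg.mp h5 with h6 | h6
    · exact h6
    · have := hp.counit_pos
      rw [h6] at this
      exact absurd hq.counit_pos (neg_pos.mp this).not_gt
  rw [h6] at h3
  exact smul_right_injective A hq.counit_pos.ne' h3

/-- The density `ρ` of `φ` with respect to the Haar state lies in the coidalgebra, so it is a
positive multiple of a projection, and `f = ρ / √ε(ρ)` is the square root of `ρ`. -/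
theorem IsFiniteQuantumGroup.exists_preSubgroup (hΔ : IsFiniteQuantumGroup Δ)
    (hε : IsCounit Δ ε) (hh : IsHaarState Δ h) (hφ : IsIdempotentState Δ φ) :
    ∃ f, IsPreSubgroup Δ ε h f ∧ vectorFunctional h f f = φ := by
  have hfaith := hΔ.isFaithful_haar hh
  obtain ⟨ρ, hρ⟩ := hΔ.exists_density hh φ
  have hmem : ρ ∈ coidalgebra Δ φ := by
    rw [hΔ.mem_coidalgebra_iff hφ]
    refine hfaith.eq_of_forall_mul_left fun b => ?_
    rw [← hΔ.haar_convRight_mul hh hφ, ← hρ, ← hρ, ← convolution_eq_convRight, hφ.2]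
  have hmul : ∀ x ∈ coidalgebra Δ φ, x * ρ = ε x • ρ := by
    intro x hx
    refine hfaith.eq_of_forall_mul_left fun b => ?_
    rw [← mul_assoc, ← hρ, hΔ.map_mul_of_mem hε hφ hx, mul_smul_comm, map_smul, ← hρ,
      smul_eq_mul, mul_comm]
  have hone : h ρ = 1 := by rw [← one_mul ρ, ← hρ, hφ.1.2]
  have hρ0 : ρ ≠ 0 := by
    rintro rfl
    simp at hone
  have hs : star ρ * ρ = star (ε ρ) • ρ := by
    rw [hmul _ (hΔ.star_mem_coidalgebra hφ hmem), star_counit]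
  have hpos : 0 < star (ε ρ) := by
    have h1 : h (star ρ * ρ) = star (ε ρ) := by rw [hs, map_smul, hone, smul_eq_mul, mul_one]
    rw [← h1]
    exact lt_of_le_of_ne (hh.1.1 ρ) fun h0 => hρ0 (hfaith ρ h0.symm)
  have hreal : star (ε ρ) = ε ρ := by
    rw [← (IsSelfAdjoint.of_nonneg hpos.le).star_eq, star_star]
  rw [hreal] at hs hpos
  have hsa : star ρ = ρ := by
    have h1 := congrArg star hs
    rw [star_mul, star_star, hs, star_smul, hreal] at h1
    exact (smul_right_injective A hpos.ne' h1).symm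
  obtain ⟨t, ht, hεt⟩ : ∃ t : ℝ, 0 < t ∧ ε ρ = (t : ℂ) ^ 2 := by
    obtain ⟨r, hr, hr'⟩ := RCLike.pos_iff_exists_ofReal.mp hpos
    refine ⟨√r, Real.sqrt_pos.mpr hr, ?_⟩
    rw [← hr', ← Complex.ofReal_pow, Real.sq_sqrt hr.le]
    rfl
  have htc : (t : ℂ) ≠ 0 := by exact_mod_cast ht.ne'
  have hst : star ((t : ℂ)⁻¹) = (t : ℂ)⁻¹ := by simp
  have hρρ : ρ * ρ = (t : ℂ) ^ 2 • ρ := by rw [← hεt, hmul ρ hmem]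
  have hcomm : ∀ a, h (ρ * a) = h (a * ρ) := fun a => hΔ.haar_mul_comm hh ρ a
  refine ⟨(t : ℂ)⁻¹ • ρ, ⟨?_, ?_, ?_⟩, ?_⟩
  · simp only [star_smul, hst, hsa, smul_mul_smul_comm, hρρ, smul_smul, map_smul, hone,
      smul_eq_mul]
    field_simp
  · rw [map_smul, hεt, smul_eq_mul]
    have : (t : ℂ)⁻¹ * (t : ℂ) ^ 2 = t := by field_simp
    rw [this]
    exact_mod_cast ht
  · have hZ : ∀ Z : A ⊗[ℂ] A,
        (convRight Δ φ).lTensor A Z * 1 ⊗ₜ ρ = sliceRight φ Z ⊗ₜ ρ := by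
      intro Z
      induction Z with
      | zero => simp
      | add X Y hX hY => simp only [map_add, add_mul, TensorProduct.add_tmul, hX, hY]
      | tmul a b =>
        simp [hmul _ (convRight_mem_coidalgebra Δ φ b), hε.counit_convRight,
          TensorProduct.smul_tmul]
    have h1 : Δ ρ * 1 ⊗ₜ ρ = ρ ⊗ₜ ρ := by
      have hfix := (hΔ.mem_coidalgebra_iff hφ).mp hmem
      have hcomul : Δ ρ = (convRight Δ φ).lTensor A (Δ ρ) := by
        rw [← hΔ.comul_convRight, hfix]
      rw [hcomul, hZ, ← convRight_apply, hfix]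
    rw [TensorProduct.smul_tmul_smul, map_smul, multiplicativeUnitary_tmul, h1]
  · ext a
    rw [vectorFunctional_apply, star_smul, hst, hsa]
    simp only [smul_mul_assoc, mul_smul_comm, map_smul, mul_assoc, hcomm, smul_smul, hρρ, ← hρ,
      smul_eq_mul]
    field_simp

end IdempotentState

/-! ### Quantum subgroups -/

section QuantumSubgroup

variable {ΔB : B →⋆ₐ[ℂ] B ⊗[ℂ] B} {π : A →⋆ₐ[ℂ] B}

/-- A nonzero quotient of a finite quantum group to which the comultiplication descends is a
finite quantum group. -/
theorem IsFiniteQuantumGroup.isQuantumSubgroup (hΔ : IsFiniteQuantumGroup Δ) [Nontrivial B]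
    (hπ : Function.Surjective π)
    (hcomul : ∀ a, ΔB (π a) =
      TensorProduct.map π.toAlgHom.toLinearMap π.toAlgHom.toLinearMap (Δ a)) :
    IsQuantumSubgroup Δ ΔB π := by
  have := hΔ.finiteDimensional
  let P := π.toAlgHom.toLinearMap
  have hP : Function.Surjective P := hπ
  have htop : ∀ S : Submodule ℂ (B ⊗[ℂ] B), ⊤ ≤ S.comap (TensorProduct.map P P) → S = ⊤ := by
    intro S hS
    refine eq_top_iff.mpr fun y _ => ?_
    obtain ⟨x, rfl⟩ := TensorProduct.map_surjective hP hP y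
    exact hS Submodule.mem_top
  have hmul : ∀ X Y : A ⊗[ℂ] A, TensorProduct.map P P (X * Y) =
      TensorProduct.map P P X * TensorProduct.map P P Y :=
    fun X Y => map_mul (Algebra.TensorProduct.map π.toAlgHom π.toAlgHom) X Y
  refine ⟨⟨inferInstance, FiniteDimensional.of_surjective P hP, ?_, ?_, ?_⟩, hπ, hcomul⟩
  · intro b
    obtain ⟨a, rfl⟩ := hπ b
    have h1 : ∀ (Z : A ⊗[ℂ] A) (q : A),
        TensorProduct.assoc ℂ B B B (TensorProduct.map P P Z ⊗ₜ P q) =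
        TensorProduct.map P (TensorProduct.map P P) (TensorProduct.assoc ℂ A A A (Z ⊗ₜ q)) := by
      intro Z q
      induction Z with
      | zero => simp
      | add X Y hX hY => simp only [TensorProduct.add_tmul, map_add, hX, hY]
      | tmul x y => simp
    have h2 : ∀ Z : A ⊗[ℂ] A, TensorProduct.assoc ℂ B B B
        (ΔB.toAlgHom.toLinearMap.rTensor B (TensorProduct.map P P Z)) =
        TensorProduct.map P (TensorProduct.map P P)
          (TensorProduct.assoc ℂ A A A (Δ.toAlgHom.toLinearMap.rTensor A Z)) := by
      intro Z
      induction Z with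
      | zero => simp
      | add X Y hX hY => simp only [map_add, hX, hY]
      | tmul x y =>
        rw [LinearMap.rTensor_tmul, ← h1, TensorProduct.map_tmul, LinearMap.rTensor_tmul]
        exact congrArg (fun W => TensorProduct.assoc ℂ B B B (W ⊗ₜ[ℂ] P y)) (hcomul x)
    have h3 : ∀ Z : A ⊗[ℂ] A,
        ΔB.toAlgHom.toLinearMap.lTensor B (TensorProduct.map P P Z) =
        TensorProduct.map P (TensorProduct.map P P) (Δ.toAlgHom.toLinearMap.lTensor A Z) := by
      intro Z
      induction Z with
      | zero => simp
      | add X Y hX hY => simp only [map_add, hX, hY]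
      | tmul x y => exact congrArg (fun W => P x ⊗ₜ[ℂ] W) (hcomul y)
    rw [hcomul, h2, hΔ.coassoc, h3]
  · refine htop _ ?_
    rw [← hΔ.span_right, Submodule.span_le]
    rintro _ ⟨a, b, rfl⟩
    refine Submodule.subset_span ⟨π a, π b, ?_⟩
    rw [hmul, hcomul]
    simp [P]
  · refine htop _ ?_
    rw [← hΔ.span_left, Submodule.span_le]
    rintro _ ⟨a, b, rfl⟩
    refine Submodule.subset_span ⟨π a, π b, ?_⟩
    rw [hmul, hcomul]
    simp [P]

theorem map_sliceRight_comp (π : A →⋆ₐ[ℂ] B) (ψ : B →ₗ[ℂ] ℂ) (Z : A ⊗[ℂ] A) :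
    π (sliceRight (ψ ∘ₗ π.toAlgHom.toLinearMap) Z) = sliceRight ψ
      (TensorProduct.map π.toAlgHom.toLinearMap π.toAlgHom.toLinearMap Z) := by
  induction Z with
  | zero => simp
  | add X Y hX hY => simp only [map_add, hX, hY]
  | tmul a b => simp

theorem prodFunctional_comp (π : A →⋆ₐ[ℂ] B) (ψ : B →ₗ[ℂ] ℂ) (Z : A ⊗[ℂ] A) :
    prodFunctional (ψ ∘ₗ π.toAlgHom.toLinearMap) (ψ ∘ₗ π.toAlgHom.toLinearMap) Z =
      prodFunctional ψ ψ (TensorProduct.map π.toAlgHom.toLinearMap π.toAlgHom.toLinearMap Z) := by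
  induction Z with
  | zero => simp
  | add X Y hX hY => simp only [map_add, hX, hY]
  | tmul a b => simp

theorem IsQuantumSubgroup.isIdempotentState (hB : IsQuantumSubgroup Δ ΔB π) :
    IsIdempotentState Δ (regularTrace B ∘ₗ π.toAlgHom.toLinearMap) := by
  have hH := hB.isFiniteQuantumGroup.isHaarState_regularTrace
  refine ⟨⟨fun a => ?_, ?_⟩, ?_⟩
  · have h := hH.1.1 (π a)
    rwa [← map_star, ← map_mul] at h
  · simpa using hH.1.2
  · ext a
    rw [convolution_apply, prodFunctional_comp, ← hB.comul_comp, ← convolution_apply,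
      hB.isFiniteQuantumGroup.convolution_regularTrace]
    rfl

/-- For `φ = h_B ∘ π`, the coidalgebra is `A//B`, because `π ∘ T_φ = φ(·) 1`. -/
theorem IsFiniteQuantumGroup.coidalgebra_haar_comp (hΔ : IsFiniteQuantumGroup Δ)
    (hB : IsQuantumSubgroup Δ ΔB π) {hB' : B →ₗ[ℂ] ℂ} (hH : IsHaarState ΔB hB') :
    coidalgebra Δ (hB' ∘ₗ π.toAlgHom.toLinearMap) = quotientCoidalgebra Δ π := by
  set φ := hB' ∘ₗ π.toAlgHom.toLinearMap with hφ
  ext a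
  rw [mem_quotientCoidalgebra]
  constructor
  · rintro ⟨b, rfl⟩
    change π.toAlgHom.toLinearMap.lTensor A (Δ (convRight Δ φ b)) = convRight Δ φ b ⊗ₜ 1
    have h1 : ∀ c, π (convRight Δ φ c) = φ c • (1 : B) := fun c => by
      rw [convRight_apply, hφ, map_sliceRight_comp, ← hB.comul_comp, (hH.2 _).1]
      rfl
    have h2 : ∀ Z : A ⊗[ℂ] A, π.toAlgHom.toLinearMap.lTensor A
        ((convRight Δ φ).lTensor A Z) = sliceRight φ Z ⊗ₜ 1 := by
      intro Z
      induction Z with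
      | zero => simp
      | add X Y hX hY => simp only [map_add, TensorProduct.add_tmul, hX, hY]
      | tmul x y => simp [h1, TensorProduct.smul_tmul]
    rw [hΔ.comul_convRight, h2, convRight_apply]
  · intro ha
    refine ⟨a, ?_⟩
    have h1 : ∀ Z : A ⊗[ℂ] A, sliceRight φ Z = TensorProduct.rid ℂ A
        (hB'.lTensor A (π.toAlgHom.toLinearMap.lTensor A Z)) := by
      intro Z
      rw [← LinearMap.lTensor_comp_apply]
      rfl
    change sliceRight φ (Δ a) = a
    rw [h1, ha]
    simp [hH.1.2]

end QuantumSubgroup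

/-! ### The corner of a central projection -/

/-- A central projection of a C*-algebra. -/
structure CentralProjection (A : Type u) [CStarAlgebra A] where
  /-- The underlying element. -/
  val : A
  mul_self : val * val = val
  star_eq : star val = val
  comm : ∀ a, val * a = a * val

namespace CentralProjection

variable (p : CentralProjection A)

/-- The ideal `p A` cut out by a central projection `p`, as a `*`-subalgebra of `A` whose unit is
`p` rather than `1`. -/
def corner : NonUnitalStarSubalgebra ℂ A where
  carrier := {a | p.val * a = a}
  add_mem' {a b} ha hb := by
    change p.val * (a + b) = a + b
    rw [mul_add, ha, hb]
  zero_mem' := mul_zero _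
  mul_mem' {a b} ha _ := by
    change p.val * (a * b) = a * b
    rw [← mul_assoc, ha]
  smul_mem' c a ha := by
    change p.val * (c • a) = c • a
    rw [mul_smul_comm, ha]
  star_mem' {a} ha := by
    change p.val * star a = star a
    rw [← p.star_eq, ← star_mul, ← p.comm, ha]

theorem mem_corner {a : A} : a ∈ p.corner ↔ p.val * a = a := Iff.rfl

theorem mul_mem_corner (a : A) : p.val * a ∈ p.corner := by
  rw [mem_corner, ← mul_assoc, p.mul_self]

theorem isClosed_corner : IsClosed (p.corner : Set A) :=
  isClosed_eq (continuous_const.mul continuous_id) continuous_id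

instance : NonUnitalCStarAlgebra p.corner :=
  NonUnitalStarSubalgebra.nonUnitalCStarAlgebra p.corner (h_closed := p.isClosed_corner)

instance : NormedRing p.corner :=
  { (inferInstance : NonUnitalNormedRing p.corner) with
    one := ⟨p.val, p.mul_self⟩
    one_mul := fun a => Subtype.ext a.2
    mul_one := fun a => Subtype.ext ((p.comm _).symm.trans a.2) }

instance : NormedAlgebra ℂ p.corner :=
  { Algebra.ofModule (R := ℂ) (A := p.corner) smul_mul_assoc mul_smul_comm with
    norm_smul_le := norm_smul_le }

instance : CStarAlgebra p.corner where
  toStarRing := inferInstanceAs (StarRing p.corner)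
  toCompleteSpace := p.isClosed_corner.completeSpace_coe
  norm_mul_self_le x := (CStarRing.norm_star_mul_self (x := (x : A))).symm.le
  star_smul := star_smul

/-- Compression to the corner, `a ↦ p a`. -/
def toCorner : A →⋆ₐ[ℂ] p.corner where
  toFun a := ⟨p.val * a, p.mul_mem_corner a⟩
  map_one' := Subtype.ext (mul_one _)
  map_mul' a b := Subtype.ext (by
    change p.val * (a * b) = p.val * a * (p.val * b)
    rw [mul_assoc, ← mul_assoc a, ← p.comm a, mul_assoc, ← mul_assoc p.val p.val, p.mul_self])
  map_zero' := Subtype.ext (mul_zero _)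
  map_add' a b := Subtype.ext (mul_add _ _ _)
  commutes' c := Subtype.ext (by
    change p.val * algebraMap ℂ A c = c • p.val
    rw [← Algebra.commutes, Algebra.smul_def])
  map_star' a := Subtype.ext (by
    change p.val * star a = star (p.val * a)
    rw [star_mul, p.star_eq, p.comm])

/-- The inclusion of the corner, which is not unital. -/
def ofCorner : p.corner →ₗ[ℂ] A where
  toFun b := b
  map_add' _ _ := rfl
  map_smul' _ _ := rfl

theorem ofCorner_toCorner (a : A) : p.ofCorner (p.toCorner a) = p.val * a := rfl

theorem toCorner_ofCorner (b : p.corner) : p.toCorner (p.ofCorner b) = b := Subtype.ext b.2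

theorem ofCorner_mul (b c : p.corner) : p.ofCorner (b * c) = p.ofCorner b * p.ofCorner c := rfl

theorem ofCorner_star (b : p.corner) : p.ofCorner (star b) = star (p.ofCorner b) := rfl

theorem toCorner_val : p.toCorner p.val = 1 := Subtype.ext p.mul_self

theorem toCorner_surjective : Function.Surjective p.toCorner :=
  fun b => ⟨_, p.toCorner_ofCorner b⟩

/-- The comultiplication of the corner, available when `p` is group-like in the sense
`Δ(p)(1 ⊗ p) = p ⊗ p`. -/
def comulCorner (Δ : A →⋆ₐ[ℂ] A ⊗[ℂ] A) (hp : Δ p.val * 1 ⊗ₜ p.val = p.val ⊗ₜ p.val) :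
    p.corner →⋆ₐ[ℂ] p.corner ⊗[ℂ] p.corner where
  toAlgHom := AlgHom.ofLinearMap
    ((Algebra.TensorProduct.map p.toCorner.toAlgHom p.toCorner.toAlgHom).toLinearMap ∘ₗ
      Δ.toAlgHom.toLinearMap ∘ₗ p.ofCorner)
    (by
      have h := congrArg (Algebra.TensorProduct.map p.toCorner.toAlgHom p.toCorner.toAlgHom) hp
      simp only [map_mul, Algebra.TensorProduct.map_tmul, map_one] at h
      have h1 : p.toCorner.toAlgHom p.val = 1 := p.toCorner_val
      rw [h1, ← Algebra.TensorProduct.one_def, mul_one] at h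
      exact h)
    (fun b c => by
      simp only [LinearMap.comp_apply, ofCorner_mul, AlgHom.toLinearMap_apply, map_mul])
  map_star' b := by
    have h : ∀ Z : A ⊗[ℂ] A,
        Algebra.TensorProduct.map p.toCorner.toAlgHom p.toCorner.toAlgHom (star Z) =
        star (Algebra.TensorProduct.map p.toCorner.toAlgHom p.toCorner.toAlgHom Z) := by
      intro Z
      induction Z with
      | zero => simp
      | add X Y hX hY => simp only [star_add, map_add, hX, hY]
      | tmul x y => simp [TensorProduct.star_tmul, map_star]
    change Algebra.TensorProduct.map _ _ (Δ (p.ofCorner (star b))) = _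
    rw [ofCorner_star, map_star, h]
    rfl

theorem comulCorner_toCorner (hp : Δ p.val * 1 ⊗ₜ p.val = p.val ⊗ₜ p.val) (a : A) :
    p.comulCorner Δ hp (p.toCorner a) = TensorProduct.map p.toCorner.toAlgHom.toLinearMap
      p.toCorner.toAlgHom.toLinearMap (Δ a) := by
  change Algebra.TensorProduct.map p.toCorner.toAlgHom p.toCorner.toAlgHom
    (Δ (p.ofCorner (p.toCorner a))) =
      Algebra.TensorProduct.map p.toCorner.toAlgHom p.toCorner.toAlgHom (Δ a)
  rw [ofCorner_toCorner, map_mul, map_mul]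
  have h1 : Algebra.TensorProduct.map p.toCorner.toAlgHom p.toCorner.toAlgHom (Δ p.val) = 1 := by
    have h : p.ofCorner 1 = p.val := rfl
    rw [← h]
    exact (p.comulCorner Δ hp).map_one'
  rw [h1, one_mul]

theorem isQuantumSubgroup_corner (hΔ : IsFiniteQuantumGroup Δ) (h0 : p.val ≠ 0)
    (hp : Δ p.val * 1 ⊗ₜ p.val = p.val ⊗ₜ p.val) :
    IsQuantumSubgroup Δ (p.comulCorner Δ hp) p.toCorner := by
  have : Nontrivial p.corner :=
    ⟨1, 0, fun h => h0 (congrArg Subtype.val h)⟩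
  exact hΔ.isQuantumSubgroup p.toCorner_surjective (p.comulCorner_toCorner hp)

end CentralProjection

/-! ### Haar idempotents, subgroups and coidalgebras of quotient type -/

section Equivalence

variable {h φ : A →ₗ[ℂ] ℂ} {ε : A →ₐ[ℂ] ℂ} {f : A}

theorem IsFiniteQuantumGroup.isHaarIdempotent_iff_isQuotientType (hΔ : IsFiniteQuantumGroup Δ)
    (hφ : IsIdempotentState Δ φ) :
    IsHaarIdempotent Δ φ ↔ IsQuotientType Δ (coidalgebra Δ φ) := by
  constructor
  · rintro ⟨B, _, ΔB, π, hB', hB, hH, rfl⟩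
    exact ⟨hΔ.isRightCoidalgebra_coidalgebra hφ, B, _, ΔB, π, hB, hΔ.coidalgebra_haar_comp hB hH⟩
  · rintro ⟨-, B, _, ΔB, π, hB, hC⟩
    have hH := hB.isFiniteQuantumGroup.isHaarState_regularTrace
    refine ⟨B, _, ΔB, π, regularTrace B, hB, hH, ?_⟩
    exact hΔ.eq_of_coidalgebra_eq hφ hB.isIdempotentState
      (hC.trans (hΔ.coidalgebra_haar_comp hB hH).symm)

/-- The Haar state of the quantum subgroup is a trace, so the density of `φ` is central. -/
theorem IsFiniteQuantumGroup.isSubgroup_of_isHaarIdempotent (hΔ : IsFiniteQuantumGroup Δ)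
    (hε : IsCounit Δ ε) (hh : IsHaarState Δ h) (hφ : IsIdempotentState Δ φ)
    (hp : IsPreSubgroup Δ ε h f) (hf : vectorFunctional h f f = φ)
    (hH : IsHaarIdempotent Δ φ) : IsSubgroup Δ ε h f := by
  refine ⟨hp, Subalgebra.mem_center_iff.mpr fun b => ?_⟩
  have hφf : ∀ a, φ a = ε f * h (a * f) := by
    intro a
    rw [← hf, vectorFunctional_apply, hΔ.preSubgroup_star_eq hε hh hφ hp hf, mul_assoc,
      hΔ.haar_mul_comm hh, mul_assoc, hΔ.preSubgroup_mul_eq hε hh hφ hp hf, mul_smul_comm,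
      map_smul, smul_eq_mul]
  have htrace : ∀ a c, φ (a * c) = φ (c * a) := by
    obtain ⟨B, _, ΔB, π, hB', hB, hHB, rfl⟩ := hH
    intro a c
    simpa using hB.isFiniteQuantumGroup.haar_mul_comm hHB (π a) (π c)
  refine (hΔ.isFaithful_haar hh).eq_of_forall_mul_left fun a => ?_
  have h1 := htrace a b
  rw [hφf, hφf] at h1
  have h2 := mul_left_cancel₀ hp.counit_pos.ne' h1
  rw [← mul_assoc, h2, mul_assoc, hΔ.haar_mul_comm hh, mul_assoc]

/-- The quantum subgroup of a central pre-subgroup `f` is the corner of the projection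
`f / ε(f)`. -/
theorem IsFiniteQuantumGroup.isHaarIdempotent_of_isSubgroup (hΔ : IsFiniteQuantumGroup Δ)
    (hε : IsCounit Δ ε) (hh : IsHaarState Δ h) (hφ : IsIdempotentState Δ φ)
    (hp : IsSubgroup Δ ε h f) (hf : vectorFunctional h f f = φ) : IsHaarIdempotent Δ φ := by
  obtain ⟨hp, hcenter⟩ := hp
  have hne : ε f ≠ 0 := hp.counit_pos.ne'
  have hreal : star (ε f)⁻¹ = (ε f)⁻¹ := by
    rw [star_inv₀, (IsSelfAdjoint.of_nonneg hp.counit_pos.le).star_eq]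
  have hmem := hp.mem_coidalgebra hf
  let p : CentralProjection A :=
    { val := (ε f)⁻¹ • f
      mul_self := by
        rw [smul_mul_smul_comm, hΔ.preSubgroup_mul_eq hε hh hφ hp hf, smul_smul, mul_assoc,
          inv_mul_cancel₀ hne, mul_one]
      star_eq := by rw [star_smul, hreal, hΔ.preSubgroup_star_eq hε hh hφ hp hf]
      comm := fun a => by
        rw [smul_mul_assoc, mul_smul_comm, Subalgebra.mem_center_iff.mp hcenter a] }
  have hpv : p.val = (ε f)⁻¹ • f := rfl
  have hεp : ε p.val = 1 := by rw [hpv, map_smul, smul_eq_mul, inv_mul_cancel₀ hne]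
  have h0 : p.val ≠ 0 := fun h => by rw [h, map_zero] at hεp; exact zero_ne_one hεp
  have hpmem : p.val ∈ coidalgebra Δ φ := Submodule.smul_mem _ _ hmem
  have hfix : Δ p.val * 1 ⊗ₜ p.val = p.val ⊗ₜ p.val := by
    have := hp.fixed
    rw [multiplicativeUnitary_tmul] at this
    rw [hpv, map_smul, TensorProduct.tmul_smul, smul_mul_smul_comm, this,
      TensorProduct.smul_tmul_smul]
  have hB := p.isQuantumSubgroup_corner hΔ h0 hfix
  have hφp : ∀ a, φ (p.val * a) = φ a := fun a => by
    rw [p.comm, hΔ.map_mul_of_mem hε hφ hpmem, hεp, mul_one]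
  have hcomp : φ = (φ ∘ₗ p.ofCorner) ∘ₗ p.toCorner.toAlgHom.toLinearMap :=
    LinearMap.ext fun a => (hφp a).symm
  have hstate : IsState (φ ∘ₗ p.ofCorner) := by
    refine ⟨fun b => ?_, ?_⟩
    · rw [LinearMap.comp_apply, p.ofCorner_mul, p.ofCorner_star]
      exact hφ.1.1 _
    · rw [← p.toCorner_val, LinearMap.comp_apply, p.ofCorner_toCorner, hφp, ← mul_one p.val, hφp,
        hφ.1.2]
  -- on the coidalgebra, compression to the corner is the counit
  have hscalar : ∀ x ∈ coidalgebra Δ φ, p.toCorner x = ε x • 1 := by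
    intro x hx
    have h1 : x * p.val = ε x • p.val := by
      rw [hpv, mul_smul_comm, hΔ.mul_eq_counit_smul hε hh hφ hf hx, smul_comm]
    have h2 := congrArg p.toCorner h1
    rwa [map_mul, p.toCorner_val, mul_one, map_smul, p.toCorner_val] at h2
  have hinv : ∀ b, sliceRight (φ ∘ₗ p.ofCorner) (p.comulCorner Δ hfix b) =
      (φ ∘ₗ p.ofCorner) b • 1 := by
    intro b
    obtain ⟨a, rfl⟩ := p.toCorner_surjective b
    rw [hB.comul_comp, ← map_sliceRight_comp, ← hcomp, ← convRight_apply,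
      hscalar _ (convRight_mem_coidalgebra Δ φ a), hε.counit_convRight, LinearMap.comp_apply,
      p.ofCorner_toCorner, hφp]
  have hH := hB.isFiniteQuantumGroup.isHaarState_regularTrace
  refine ⟨p.corner, _, p.comulCorner Δ hfix, p.toCorner, φ ∘ₗ p.ofCorner, hB, ?_, hcomp⟩
  rw [eq_of_invariant hstate hH.1 hinv fun b => (hH.2 b).2]
  exact hH

end Equivalence

end FiniteQG

end

theorem proposition3p6 {A : Type u} [CStarAlgebra A] (Δ : A →⋆ₐ[ℂ] A ⊗[ℂ] A)
    (hΔ : FiniteQG.IsFiniteQuantumGroup Δ) (φ : A →ₗ[ℂ] ℂ)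
    (hφ : FiniteQG.IsIdempotentState Δ φ) :
    -- the counit and the Haar state exist and are unique
    (∃! ε : A →ₐ[ℂ] ℂ, FiniteQG.IsCounit Δ ε) ∧
    (∃! h : A →ₗ[ℂ] ℂ, FiniteQG.IsHaarState Δ h) ∧
    ∀ (ε : A →ₐ[ℂ] ℂ) (h : A →ₗ[ℂ] ℂ), FiniteQG.IsCounit Δ ε → FiniteQG.IsHaarState Δ h →
      -- the pre-subgroup `f_φ` exists and is unique, and `C_φ` is a right coidalgebra
      (∃! f : A, FiniteQG.IsPreSubgroup Δ ε h f ∧ FiniteQG.vectorFunctional h f f = φ) ∧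
      FiniteQG.IsRightCoidalgebra Δ (FiniteQG.coidalgebra Δ φ) ∧
      -- the equivalence, with `f = f_φ`
      ∀ f : A, FiniteQG.IsPreSubgroup Δ ε h f → FiniteQG.vectorFunctional h f f = φ →
        List.TFAE [
          FiniteQG.IsHaarIdempotent Δ φ,
          FiniteQG.IsSubgroup Δ ε h f,
          FiniteQG.IsQuotientType Δ (FiniteQG.coidalgebra Δ φ)] := by
  refine ⟨?_, ?_, fun ε h hε hh => ⟨?_, hΔ.isRightCoidalgebra_coidalgebra hφ, fun f hp hf => ?_⟩⟩
  · obtain ⟨ε, hε⟩ := hΔ.exists_counit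
    exact ⟨ε, hε, fun ε' hε' => hε'.unique hε⟩
  · exact ⟨_, hΔ.isHaarState_regularTrace, fun h hh => hΔ.eq_regularTrace hh⟩
  · obtain ⟨f, hp, hf⟩ := hΔ.exists_preSubgroup hε hh hφ
    exact ⟨f, ⟨hp, hf⟩, fun g hg => hΔ.preSubgroup_unique hε hh hφ hg.1 hg.2 hp hf⟩
  · tfae_have 1 → 2 := hΔ.isSubgroup_of_isHaarIdempotent hε hh hφ hp hf
    tfae_have 2 → 1 := fun h2 => hΔ.isHaarIdempotent_of_isSubgroup hε hh hφ h2 hf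
    tfae_have 1 ↔ 3 := hΔ.isHaarIdempotent_iff_isQuotientType hφ
    tfae_finish
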